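/- Let $S$ be a finite nonempty set and let $\mu:S\times S\to\mathbb R_{\ge 0}$ be a directed distance, i.e. $\mu(s,s)=0$ for all $s\in S$ (no triangle inequality and no symmetry is assumed). Let $S^c=\{s^c\}$ and $S^r=\{s^r\}$ be two disjoint copies of $S$, put $S^{cr}=S^c\cup S^r$, and for $p\in\mathbb R^{S^{cr}}$ let $p^c,p^r$ be the restrictions of $p$ to $S^c,S^r$. For $X\subseteq S$ write $X^c,X^r$ for its copies. Define $$D_\infty(p,q)=\max\Big\{\max_{s\in S}\,(q(s^c)-p(s^c))_+,\ \max_{s\in S}\,(p(s^r)-q(s^r))_+\Big\},$$ $$P_\mu=\{p\in\mathbb R^{S^{cr}} : p(s^c)+p(t^r)\ge\mu(s,t)\ \ (s,t\in S)\},\qquad Q_\mu=\{\text{minimal elements of }P_\mu\text{ in the coordinatewise order}\}.$$ For a set $R$ of points, $R^+$ is the set of its nonnegative points, and for $s\in S$ the terminal region is $R_s=\{p\in R: p(s^c)+p(s^r)=0\}$. For vectors, $<$ means strict inequality in every coordinate; $R$ is balanced if there are no $p,q\in R$ with $p^c<q^c$ or $p^r<q^r$. For $p\in Q_\mu$ let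 $K(p)$ be the bipartite graph on $S^{cr}$ with edges $s^ct^r$ for $p(s^c)+p(t^r)=\mu(s,t)$, and let $N_p(U)$ be the set of nodes outside $U$ adjacent to a node of $U$. Let $\mathcal S_0$ be the family of $X\subseteq S$ with $\mu=0$ on $X\times X$. For $X\in\mathcal S_0$ let $Q_{\mu,X}$ be the set of $p\in Q_\mu$ such that, for every $s\in S$, $s^cs^r$ is an edge of $K(p)$ if and only if $s\in X$. A point $p\in Q_{\mu,X}$ is a fat relative to $X$ if $N_p(S^c\setminus X^c)\subseteq S^r\setminus X^r$ or $N_p(S^r\setminus X^r)\subseteq S^c\setminus X^c$; the degenerate set $Q_{\mu,X}^{deg}$ consists of the $p\in Q_{\mu,X}$ for which one of these two inclusions is an equality. A proper fat is a fat (relative to some $X\in\mathcal S_0$) that lies in no degenerate set. Let $Q_\mu^{slim}$ be $Q_\mu$ with all proper fats removed. On $Q_\mu^{slim}$ let $p\sim q$ if $p-q\in\mathbb R(\mathbf 1,-\mathbf 1)$, or if for some $X\in\mathcal S_0$ both $p,q\in Q_{\mu,X}^{deg}$ and $p-q\in\mathbb R(\mathbf 1,-\mathbf 1)+\mathbb R(\mathbf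 1_{X^c},-\mathbf 1_{X^r})$; this is an equivalence relation. A section is a subset of $Q_\mu^{slim}$ that the projection maps bijectively onto $Q_\mu^{slim}/\!\sim$. A slimmed section in $(Q_\mu^{slim})^+$ is a balanced section $R\subseteq(Q_\mu^{slim})^+$ such that for each $X\in\mathcal S_0$ with $X\neq S$ there are no $p,q\in R\cap(Q_{\mu,X}^{deg})^+$ with $p(s^c)<q(s^c)$ for all $s\in S\setminus X$, or with $p(s^r)<q(s^r)$ for all $s\in S\setminus X$. A slimmed section (in $Q_\mu^{slim}$) is a balanced section $R$ such that $R/(\mathbf 1,-\mathbf 1)\mathbb R=R'/(\mathbf 1,-\mathbf 1)\mathbb R$ for some slimmed section $R'$ in $(Q_\mu^{slim})^+$. A set $R$ is geodesic if for any two distinct $p,q\in R$ there is an injective continuous map $\varrho:[0,1]\to R$ with $\varrho(0)=p$, $\varrho(1)=q$ whose length from $p$ to $q$, namely the supremum of $\sum_{i=0}^{n-1}D_\infty(\varrho(t_i),\varrho(t_{i+1}))$ over all $n>0$ and $0=t_0<t_1<\dots<t_n=1$, equals $D_\infty(p,q)$. **Statement.** Let $R\subseteq Q_\mu$ be a slimmed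 section. 1. $R$ is contractible (in the Euclidean topology) and geodesic, and so is $R_s$ for every $s\in S$. 2. If $R\subseteq Q_\mu^+$, then for all $s,t\in S$, $$D_\infty(R_s,R_t):=\inf\{D_\infty(p,q): p\in R_s,\ q\in R_t\}=\mu(s,t).$$ -/

import Mathlib

namespace SlimTropical

/-- Points of `ℝ^{S^c ∪ S^r}`; `Sum.inl s` is the element `s^c` and `Sum.inr s` is `s^r`. -/
abbrev Pt (S : Type*) := S ⊕ S → ℝ

/-- A directed distance on `S`: nonnegative, with zero diagonal. -/
structure IsDirectedDistance {S : Type*} (μ : S → S → ℝ) : Prop where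
  nonneg : ∀ s t, 0 ≤ μ s t
  diag : ∀ s, μ s s = 0

/-- `D_∞^+(p, q) = ‖(q - p)_+‖_∞` on `ℝ^X`. -/
noncomputable def dPlus {X : Type*} [Fintype X] (p q : X → ℝ) : ℝ :=
  ‖fun x => max (q x - p x) 0‖

/-- `D_∞(p, q) = max (D_∞^+(p^c, q^c)) (D_∞^+(q^r, p^r))`. -/
noncomputable def dInf {S : Type*} [Fintype S] (p q : Pt S) : ℝ :=
  max (dPlus (fun s => p (Sum.inl s)) (fun s => q (Sum.inl s)))
    (dPlus (fun s => q (Sum.inr s)) (fun s => p (Sum.inr s)))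

section Polyhedra

variable {S : Type*}

/-- The polyhedron `P_μ`. -/
def P (μ : S → S → ℝ) : Set (Pt S) :=
  {p | ∀ s t, μ s t ≤ p (Sum.inl s) + p (Sum.inr t)}

/-- `Q_μ`, the set of minimal elements of `P_μ` for the coordinatewise order. -/
def Q (μ : S → S → ℝ) : Set (Pt S) :=
  {p | Minimal (fun q => q ∈ P μ) p}

/-- `R^+`, the set of nonnegative points of `R`. -/
def nonnegPart (R : Set (Pt S)) : Set (Pt S) := {p | p ∈ R ∧ ∀ u, 0 ≤ p u}

/-- The terminal region `R_s` of `R`. -/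
def region (R : Set (Pt S)) (s : S) : Set (Pt S) :=
  {p | p ∈ R ∧ p (Sum.inl s) + p (Sum.inr s) = 0}

/-- No two points `p, q` of `R` have `p^c < q^c` or `p^r < q^r`, where `<` means strictly smaller
in every coordinate. -/
def IsBalanced (R : Set (Pt S)) : Prop :=
  ¬ ∃ p ∈ R, ∃ q ∈ R, (∀ s, p (Sum.inl s) < q (Sum.inl s)) ∨ (∀ s, p (Sum.inr s) < q (Sum.inr s))

/-- The vector `(𝟙_{X^c}, -𝟙_{X^r})`. -/
noncomputable def dirVec (X : Set S) : Pt S :=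
  Sum.elim (X.indicator (fun _ => (1 : ℝ))) (fun s => -X.indicator (fun _ => (1 : ℝ)) s)

/-- The line `(𝟙, -𝟙)ℝ`. -/
noncomputable def diagLine (S : Type*) : Submodule ℝ (Pt S) :=
  Submodule.span ℝ {dirVec Set.univ}

/-- The bipartite graph `K(p)` on `S^c ∪ S^r`. -/
def K (μ : S → S → ℝ) (p : Pt S) : SimpleGraph (S ⊕ S) :=
  SimpleGraph.fromRel fun u v =>
    ∃ s t, u = Sum.inl s ∧ v = Sum.inr t ∧ p (Sum.inl s) + p (Sum.inr t) = μ s t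

/-- `N_p(U)`: the nodes outside `U` adjacent in `K(p)` to a node of `U`. -/
def N (μ : S → S → ℝ) (p : Pt S) (U : Set (S ⊕ S)) : Set (S ⊕ S) :=
  {v | v ∉ U ∧ ∃ u ∈ U, (K μ p).Adj u v}

/-- `X ∈ 𝓢₀`: `μ` vanishes on `X × X`. -/
def IsNull (μ : S → S → ℝ) (X : Set S) : Prop := ∀ s ∈ X, ∀ t ∈ X, μ s t = 0

/-- `Q_{μ,X}`. -/
def QX (μ : S → S → ℝ) (X : Set S) : Set (Pt S) :=
  {p | p ∈ Q μ ∧ ∀ s, (K μ p).Adj (Sum.inl s) (Sum.inr s) ↔ s ∈ X}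

/-- `p` is a fat relative to `X`; here `Sum.inl '' Xᶜ` is `S^c \ X^c`, and likewise for `inr`. -/
def IsFatRel (μ : S → S → ℝ) (X : Set S) (p : Pt S) : Prop :=
  p ∈ QX μ X ∧
    (N μ p (Sum.inl '' Xᶜ) ⊆ Sum.inr '' Xᶜ ∨ N μ p (Sum.inr '' Xᶜ) ⊆ Sum.inl '' Xᶜ)

/-- The degenerate set `Q_{μ,X}^{deg}`. -/
def Qdeg (μ : S → S → ℝ) (X : Set S) : Set (Pt S) :=
  {p | p ∈ QX μ X ∧
    (N μ p (Sum.inl '' Xᶜ) = Sum.inr '' Xᶜ ∨ N μ p (Sum.inr '' Xᶜ) = Sum.inl '' Xᶜ)}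

/-- A proper fat: a fat (relative to some `X ∈ 𝓢₀`) lying in no degenerate set. -/
def IsProperFat (μ : S → S → ℝ) (p : Pt S) : Prop :=
  (∃ X, IsNull μ X ∧ IsFatRel μ X p) ∧ ¬ ∃ X, IsNull μ X ∧ p ∈ Qdeg μ X

/-- `Q_μ^{slim}`. -/
def Qslim (μ : S → S → ℝ) : Set (Pt S) := {p | p ∈ Q μ ∧ ¬ IsProperFat μ p}

/-- The relation `∼`. -/
def SlimRel (μ : S → S → ℝ) (p q : Pt S) : Prop :=
  p - q ∈ diagLine S ∨
    ∃ X, IsNull μ X ∧ p ∈ Qdeg μ X ∧ q ∈ Qdeg μ X ∧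
      p - q ∈ diagLine S ⊔ Submodule.span ℝ {dirVec X}

theorem mem_diagLine {v : Pt S} :
    v ∈ diagLine S ↔ ∃ a : ℝ, (∀ s, v (Sum.inl s) = a) ∧ ∀ s, v (Sum.inr s) = -a := by
  unfold diagLine
  rw [Submodule.mem_span_singleton]
  constructor
  · rintro ⟨a, rfl⟩
    exact ⟨a, fun s => by simp [dirVec], fun s => by simp [dirVec]⟩
  · rintro ⟨a, h1, h2⟩
    refine ⟨a, ?_⟩
    ext u
    rcases u with s | s
    · simp [dirVec, h1]
    · simp [dirVec, h2]

theorem sum_eq_of_sub_mem {p q : Pt S} (h : p - q ∈ diagLine S) (s t : S) :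
    p (Sum.inl s) + p (Sum.inr t) = q (Sum.inl s) + q (Sum.inr t) := by
  obtain ⟨a, h1, h2⟩ := mem_diagLine.1 h
  have e1 := h1 s
  have e2 := h2 t
  simp only [Pi.sub_apply] at e1 e2
  linarith

theorem P_of_sub_mem {μ : S → S → ℝ} {p q : Pt S} (h : p - q ∈ diagLine S) (hq : q ∈ P μ) :
    p ∈ P μ := fun s t => by
  rw [sum_eq_of_sub_mem h]
  exact hq s t

theorem Q_of_sub_mem {μ : S → S → ℝ} {p q : Pt S} (h : p - q ∈ diagLine S) (hq : q ∈ Q μ) :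
    p ∈ Q μ := by
  refine ⟨P_of_sub_mem h hq.1, fun y hy hle => ?_⟩
  have h1 : (y - (p - q)) - y ∈ diagLine S := by
    have e : (y - (p - q)) - y = -(p - q) := by abel
    rw [e]
    exact neg_mem h
  have h2 : y - (p - q) ≤ q := fun u => by
    have := hle u
    simp only [Pi.sub_apply]
    linarith
  intro u
  have := hq.2 (P_of_sub_mem h1 hy) h2 u
  simp only [Pi.sub_apply] at this
  linarith

theorem K_of_sub_mem {μ : S → S → ℝ} {p q : Pt S} (h : p - q ∈ diagLine S) : K μ p = K μ q := by
  unfold K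
  simp only [sum_eq_of_sub_mem h]

theorem Qdeg_of_sub_mem {μ : S → S → ℝ} {X : Set S} {p q : Pt S} (h : p - q ∈ diagLine S)
    (hq : q ∈ Qdeg μ X) : p ∈ Qdeg μ X := by
  simp only [Qdeg, QX, N, Set.mem_ofPred_eq, K_of_sub_mem h] at hq ⊢
  exact ⟨⟨Q_of_sub_mem h hq.1.1, hq.1.2⟩, hq.2⟩

theorem slimRel_equivalence (μ : S → S → ℝ) : Equivalence (SlimRel μ) where
  refl p := Or.inl (by simp)
  symm := by
    rintro p q (h | ⟨X, hX, hp, hq, h⟩)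
    · exact Or.inl (by simpa using neg_mem h)
    · exact Or.inr ⟨X, hX, hq, hp, by simpa using neg_mem h⟩
  trans := by
    rintro p q r (h | ⟨X, hX, hp, hq, h⟩) (h' | ⟨Y, hY, hq', hr, h'⟩)
    · exact Or.inl (by simpa using add_mem h h')
    · refine Or.inr ⟨Y, hY, Qdeg_of_sub_mem h hq', hr, ?_⟩
      simpa using add_mem (Submodule.mem_sup_left h) h'
    · refine Or.inr ⟨X, hX, hp, Qdeg_of_sub_mem (by simpa using neg_mem h') hq, ?_⟩
      simpa using add_mem h (Submodule.mem_sup_left h')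
    · have e : X = Y := by
        ext s
        rw [← hq.1.2 s, ← hq'.1.2 s]
      subst e
      exact Or.inr ⟨X, hX, hp, hr, by simpa using add_mem h h'⟩

/-- The relation `∼` on `Q_μ^{slim}`. -/
def slimSetoid (μ : S → S → ℝ) : Setoid (Qslim μ) where
  r p q := SlimRel μ p q
  iseqv := ⟨fun p => (slimRel_equivalence μ).refl p, fun h => (slimRel_equivalence μ).symm h,
    fun h h' => (slimRel_equivalence μ).trans h h'⟩

/-- The slimmed tropical polytope `Q_μ^{slim}/∼`. -/
abbrev SlimPolytope (μ : S → S → ℝ) := Quotient (slimSetoid μ)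

/-- A section: a subset of `Q_μ^{slim}` projected bijectively onto `Q_μ^{slim}/∼`. -/
structure IsSection (μ : S → S → ℝ) (R : Set (Pt S)) : Prop where
  subset : R ⊆ Qslim μ
  bijective : Function.Bijective
    (fun r : R => (Quotient.mk (slimSetoid μ) ⟨r.1, subset r.2⟩ : SlimPolytope μ))

/-- A slimmed section in `(Q_μ^{slim})^+`. For `X = S` there is no coordinate to compare, and the
last condition says nothing. -/
structure IsSlimmedSectionPos (μ : S → S → ℝ) (R : Set (Pt S)) : Prop where
  isSection : IsSection μ R
  subset_nonneg : R ⊆ nonnegPart (Qslim μ)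
  balanced : IsBalanced R
  deg_balanced : ∀ X, IsNull μ X → X ≠ Set.univ →
    ¬ ∃ p ∈ R ∩ nonnegPart (Qdeg μ X), ∃ q ∈ R ∩ nonnegPart (Qdeg μ X),
      (∀ s ∉ X, p (Sum.inl s) < q (Sum.inl s)) ∨ (∀ s ∉ X, p (Sum.inr s) < q (Sum.inr s))

/-- A slimmed section in `Q_μ^{slim}`. -/
structure IsSlimmedSection (μ : S → S → ℝ) (R : Set (Pt S)) : Prop where
  isSection : IsSection μ R
  balanced : IsBalanced R
  exists_pos : ∃ R', IsSlimmedSectionPos μ R' ∧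
    (diagLine S).mkQ '' R = (diagLine S).mkQ '' R'

end Polyhedra

/-- `ℓ` is the length, from `ϱ(0)` to `ϱ(1)`, of the path `ϱ` with respect to `D_∞`. -/
def HasLength {S : Type*} [Fintype S] (ϱ : unitInterval → Pt S) (ℓ : ℝ) : Prop :=
  IsLUB {L : ℝ | ∃ n : ℕ, 0 < n ∧ ∃ t : Fin (n + 1) → unitInterval,
    StrictMono t ∧ t 0 = 0 ∧ t (Fin.last n) = 1 ∧
      L = ∑ i : Fin n, dInf (ϱ (t i.castSucc)) (ϱ (t i.succ))} ℓ

/-- Any two distinct points `p, q` of `R` are joined by an injective path in `R` whose length from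
`p` to `q` is `D_∞(p, q)`. (For `p = q` the one-point path has length `0`.) -/
def IsGeodesic {S : Type*} [Fintype S] (R : Set (Pt S)) : Prop :=
  ∀ p ∈ R, ∀ q ∈ R, p ≠ q → ∃ ϱ : unitInterval → Pt S,
    Continuous ϱ ∧ Function.Injective ϱ ∧ (∀ x, ϱ x ∈ R) ∧ ϱ 0 = p ∧ ϱ 1 = q ∧
      HasLength ϱ (dInf p q)

end SlimTropical

namespace SlimTropical

open Sum (inl inr)

/-! ### Directed and symmetrized sup-distances -/

section Distance

variable {S : Type*} [Fintype S]

/-! Tight points (`IsTight`) are the minimal nonnegative points of P_μ. Such a point is determined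
by its S^c-coordinates, and `hull` maps the nonnegative orthant of ℝ^S onto the tight points without
expanding distances. The proof works with the symmetrized distance `dSym`, the sum of D_∞ in both
directions. By balance this distance depends only on classes modulo (𝟙,-𝟙)ℝ (`IsBalanced.dSym_le`),
so R may be compared with a slimmed section R' of nonnegative points, all of them tight.

The heart is a `dSym`-nonexpanding retraction of the tight span onto R'
(`IsCore.exists_retraction`). A tight point off R' is pushed either down by `flow`, which lowers S^c
at unit speed, or up by the mirror image, until it meets R'. The points to be pushed down form a set
that is open and upward closed in the S^c-coordinates (`IsCore.exists_isDown_of_gt`) and disjoint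
from the set pushed up. Seen from a point q that is not pushed down, a descent of duration a adds at
most a to one directed distance and subtracts at least a from the other (`LandsDown.dSym_le`).

Thus R embeds isometrically in a convex set and is a nonexpanding image of it, which gives
contractibility. The image of a segment is a shortest path for `dSym`; since D_∞ satisfies the
triangle inequality in each direction, the path is also shortest for D_∞. Terminal regions come from
a smaller convex set, because the retraction preserves zeros.

In the distance formula, ≥ is the defining inequality of P_μ. For ≤, an explicit tight point
vanishing at s is retracted, then one vanishing at t built from the result; neither is pushed in the
direction that would spoil its estimate. -/

theorem dPlus_nonneg (x y : S → ℝ) : 0 ≤ dPlus x y := norm_nonneg _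

theorem dPlus_le_iff {x y : S → ℝ} {a : ℝ} : dPlus x y ≤ a ↔ 0 ≤ a ∧ ∀ s, y s ≤ x s + a := by
  constructor
  · intro h
    have ha : 0 ≤ a := (dPlus_nonneg x y).trans h
    refine ⟨ha, fun s => ?_⟩
    have := (pi_norm_le_iff_of_nonneg ha).1 h s
    rw [Real.norm_of_nonneg (le_max_right _ _)] at this
    linarith [le_max_left (y s - x s) 0]
  · rintro ⟨ha, h⟩
    refine (pi_norm_le_iff_of_nonneg ha).2 fun s => ?_
    rw [Real.norm_of_nonneg (le_max_right _ _)]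
    exact max_le (by linarith [h s]) ha

theorem le_add_dPlus (x y : S → ℝ) (s : S) : y s ≤ x s + dPlus x y :=
  (dPlus_le_iff.1 le_rfl).2 s

theorem dPlus_mul_sub (x v : S → ℝ) {a : ℝ} (ha : 0 ≤ a) (b : ℝ) :
    dPlus (fun s => x s + b * v s) (fun s => x s + (b + a) * v s) = a * dPlus 0 v := by
  unfold dPlus
  rw [← Real.norm_of_nonneg ha, ← norm_smul, Real.norm_of_nonneg ha]
  congr 1
  ext s
  simp only [Pi.smul_apply, smul_eq_mul, Pi.zero_apply, sub_zero]
  rw [mul_max_of_nonneg _ _ ha]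
  congr 1 <;> ring

theorem dInf_nonneg (p q : Pt S) : 0 ≤ dInf p q := (dPlus_nonneg _ _).trans (le_max_left _ _)

theorem dInf_le_iff {p q : Pt S} {a : ℝ} : dInf p q ≤ a ↔
    0 ≤ a ∧ (∀ s, q (inl s) ≤ p (inl s) + a) ∧ ∀ s, p (inr s) ≤ q (inr s) + a := by
  unfold dInf
  rw [max_le_iff, dPlus_le_iff, dPlus_le_iff]
  tauto

theorem inl_le_add_dInf (p q : Pt S) (s : S) : q (inl s) ≤ p (inl s) + dInf p q :=
  (dInf_le_iff.1 le_rfl).2.1 s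

theorem inr_le_add_dInf (p q : Pt S) (s : S) : p (inr s) ≤ q (inr s) + dInf p q :=
  (dInf_le_iff.1 le_rfl).2.2 s

theorem dInf_self (p : Pt S) : dInf p p = 0 :=
  le_antisymm (dInf_le_iff.2 ⟨le_rfl, by simp, by simp⟩) (dInf_nonneg _ _)

theorem dInf_triangle (p q r : Pt S) : dInf p r ≤ dInf p q + dInf q r := by
  refine dInf_le_iff.2 ⟨add_nonneg (dInf_nonneg _ _) (dInf_nonneg _ _), fun s => ?_, fun s => ?_⟩
  · linarith [inl_le_add_dInf p q s, inl_le_add_dInf q r s]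
  · linarith [inr_le_add_dInf p q s, inr_le_add_dInf q r s]

/-- The symmetrized distance `D_∞(p, q) + D_∞(q, p)`. -/
noncomputable def dSym (p q : Pt S) : ℝ := dInf p q + dInf q p

theorem dSym_comm (p q : Pt S) : dSym p q = dSym q p := add_comm _ _

theorem abs_sub_le_dSym (p q : Pt S) (w : S ⊕ S) : |p w - q w| ≤ dSym p q := by
  have h1 := dInf_nonneg p q
  have h2 := dInf_nonneg q p
  unfold dSym
  rcases w with s | s
  · rw [abs_le]
    constructor <;> linarith [inl_le_add_dInf p q s, inl_le_add_dInf q p s]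
  · rw [abs_le]
    constructor <;> linarith [inr_le_add_dInf p q s, inr_le_add_dInf q p s]

theorem dist_le_dSym (p q : Pt S) : dist p q ≤ dSym p q :=
  (dist_pi_le_iff (add_nonneg (dInf_nonneg _ _) (dInf_nonneg _ _))).2 fun w => by
    rw [Real.dist_eq]
    exact abs_sub_le_dSym p q w

theorem dInf_le_dist (p q : Pt S) : dInf p q ≤ dist p q := by
  refine dInf_le_iff.2 ⟨dist_nonneg, fun s => ?_, fun s => ?_⟩
  · have := dist_le_pi_dist p q (inl s)
    rw [Real.dist_eq, abs_le] at this
    linarith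
  · have := dist_le_pi_dist p q (inr s)
    rw [Real.dist_eq, abs_le] at this
    linarith

theorem eq_of_dSym_le_zero {p q : Pt S} (h : dSym p q ≤ 0) : p = q :=
  dist_le_zero.1 ((dist_le_dSym p q).trans h)

/-- The symmetrized distance `max (y - x)_+ + max (x - y)_+` on `ℝ^S`. -/
noncomputable def vSym (x y : S → ℝ) : ℝ := dPlus x y + dPlus y x

theorem dist_le_vSym (x y : S → ℝ) : dist x y ≤ vSym x y := by
  have h1 := dPlus_nonneg x y
  have h2 := dPlus_nonneg y x
  refine (dist_pi_le_iff (add_nonneg h1 h2)).2 fun s => ?_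
  rw [Real.dist_eq, abs_le]
  constructor <;> linarith [le_add_dPlus x y s, le_add_dPlus y x s]

theorem vSym_le_two_dist (x y : S → ℝ) : vSym x y ≤ 2 * dist x y := by
  have h (x y : S → ℝ) : dPlus x y ≤ dist x y := by
    refine dPlus_le_iff.2 ⟨dist_nonneg, fun s => ?_⟩
    have := dist_le_pi_dist x y s
    rw [Real.dist_eq, abs_le] at this
    linarith
  have h1 := h x y
  have h2 := h y x
  rw [dist_comm] at h2
  unfold vSym
  linarith

end Distance

/-! ### Symmetry exchanging the two copies of S -/

section Swap

variable {S : Type*}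

/-- The reversed distance. -/
abbrev tr (μ : S → S → ℝ) : S → S → ℝ := fun s t => μ t s

/-- Exchange of the two copies of `S`. -/
def swapPt (p : Pt S) : Pt S := fun u => p u.swap

@[simp] theorem swapPt_inl (p : Pt S) (s : S) : swapPt p (inl s) = p (inr s) := rfl

@[simp] theorem swapPt_inr (p : Pt S) (s : S) : swapPt p (inr s) = p (inl s) := rfl

@[simp] theorem swapPt_swapPt (p : Pt S) : swapPt (swapPt p) = p := by
  ext u
  simp [swapPt]

/-- The image of a set of points under the exchange of the two copies of `S`. -/
def swapSet (R : Set (Pt S)) : Set (Pt S) := {p | swapPt p ∈ R}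

@[simp] theorem mem_swapSet {R : Set (Pt S)} {p : Pt S} : p ∈ swapSet R ↔ swapPt p ∈ R := Iff.rfl

@[simp] theorem swapSet_swapSet (R : Set (Pt S)) : swapSet (swapSet R) = R := by
  ext p
  simp

theorem dInf_swap [Fintype S] (p q : Pt S) : dInf (swapPt p) (swapPt q) = dInf q p :=
  max_comm _ _

theorem dSym_swap [Fintype S] (p q : Pt S) : dSym (swapPt p) (swapPt q) = dSym p q := by
  simp [dSym, dInf_swap, add_comm]

end Swap

/-! ### The tight span, its hull map and the downward flow -/

section Tight

variable {S : Type*}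

/-- Points of the tight span: nonnegative points of `P_μ` all of whose positive coordinates lie on
a tight edge. -/
structure IsTight (μ : S → S → ℝ) (p : Pt S) : Prop where
  nonneg : ∀ w, 0 ≤ p w
  le : ∀ s t, μ s t ≤ p (inl s) + p (inr t)
  cov_c : ∀ s, p (inl s) = 0 ∨ ∃ t, p (inl s) + p (inr t) = μ s t
  cov_r : ∀ t, p (inr t) = 0 ∨ ∃ s, p (inl s) + p (inr t) = μ s t

theorem IsTight.swap {μ : S → S → ℝ} {p : Pt S} (h : IsTight μ p) : IsTight (tr μ) (swapPt p) where
  nonneg w := h.nonneg _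
  le s t := by simpa [add_comm] using h.le t s
  cov_c s := by simpa [add_comm] using h.cov_r s
  cov_r s := by simpa [add_comm] using h.cov_c s

/-- A positive coordinate of p at t^r lies on a tight edge, and feasibility of q along that edge
transfers the bound. Hence D_∞ between tight points can be read off from S^c alone. -/
theorem IsTight.inr_le {μ : S → S → ℝ} {p q : Pt S} (hp : IsTight μ p) (hq : IsTight μ q) {a : ℝ}
    (ha : 0 ≤ a) (h : ∀ s, q (inl s) ≤ p (inl s) + a) (t : S) : p (inr t) ≤ q (inr t) + a := by
  rcases hp.cov_r t with h0 | ⟨s, hs⟩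
  · linarith [hq.nonneg (inr t)]
  · linarith [hq.le s t, h s]

theorem IsTight.inl_le {μ : S → S → ℝ} {p q : Pt S} (hp : IsTight μ p) (hq : IsTight μ q) {a : ℝ}
    (ha : 0 ≤ a) (h : ∀ s, q (inr s) ≤ p (inr s) + a) (t : S) : p (inl t) ≤ q (inl t) + a :=
  hp.swap.inr_le hq.swap ha h t

variable [Fintype S]

theorem IsTight.dInf_le {μ : S → S → ℝ} {p q : Pt S} (hp : IsTight μ p) (hq : IsTight μ q) {a : ℝ}
    (ha : 0 ≤ a) (h : ∀ s, q (inl s) ≤ p (inl s) + a) : dInf p q ≤ a :=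
  dInf_le_iff.2 ⟨ha, h, hp.inr_le hq ha h⟩

theorem IsTight.dInf_eq {μ : S → S → ℝ} {p q : Pt S} (hp : IsTight μ p) (hq : IsTight μ q) :
    dInf p q = dPlus (fun s => p (inl s)) (fun s => q (inl s)) :=
  le_antisymm (hp.dInf_le hq (dPlus_nonneg _ _) (le_add_dPlus _ _)) (le_max_left _ _)

theorem IsTight.eq_of_inl {μ : S → S → ℝ} {p q : Pt S} (hp : IsTight μ p) (hq : IsTight μ q)
    (h : ∀ s, p (inl s) = q (inl s)) : p = q := by
  refine eq_of_dSym_le_zero (add_nonpos ?_ ?_)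
  · exact hp.dInf_le hq le_rfl (by simp [h])
  · exact hq.dInf_le hp le_rfl (by simp [h])

/-- The least nonnegative `y` with `x s + y t ≥ μ s t` for all `s`, `t`. -/
noncomputable def dual (μ : S → S → ℝ) (x : S → ℝ) (t : S) : ℝ := dPlus x fun s => μ s t

theorem dual_nonneg (μ : S → S → ℝ) (x : S → ℝ) (t : S) : 0 ≤ dual μ x t := dPlus_nonneg _ _

theorem dual_le_iff {μ : S → S → ℝ} {x : S → ℝ} {t : S} {a : ℝ} :
    dual μ x t ≤ a ↔ 0 ≤ a ∧ ∀ s, μ s t ≤ x s + a := dPlus_le_iff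

theorem le_add_dual (μ : S → S → ℝ) (x : S → ℝ) (s t : S) : μ s t ≤ x s + dual μ x t :=
  (dual_le_iff.1 le_rfl).2 s

theorem dual_eq_zero_or (μ : S → S → ℝ) (x : S → ℝ) (t : S) :
    dual μ x t = 0 ∨ ∃ s, x s + dual μ x t = μ s t := by
  cases isEmpty_or_nonempty S
  · exact Or.inl (le_antisymm (dual_le_iff.2 ⟨le_rfl, fun s => isEmptyElim s⟩) (dual_nonneg _ _ _))
  obtain ⟨s, hs⟩ := Finite.exists_max fun s => μ s t - x s
  by_cases h : μ s t - x s ≤ 0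
  · refine Or.inl (le_antisymm (dual_le_iff.2 ⟨le_rfl, fun u => ?_⟩) (dual_nonneg _ _ _))
    linarith [hs u]
  · refine Or.inr ⟨s, le_antisymm ?_ (le_add_dual μ x s t)⟩
    have : dual μ x t ≤ μ s t - x s := dual_le_iff.2 ⟨by linarith, fun u => by linarith [hs u]⟩
    linarith

theorem dual_le_dual_add {μ : S → S → ℝ} {x y : S → ℝ} {a : ℝ} (ha : 0 ≤ a)
    (h : ∀ s, y s ≤ x s + a) (t : S) : dual μ x t ≤ dual μ y t + a :=
  dual_le_iff.2 ⟨add_nonneg (dual_nonneg _ _ _) ha, fun s => by linarith [h s, le_add_dual μ y s t]⟩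

/-- The point of the tight span generated by `x`. -/
noncomputable def hull (μ : S → S → ℝ) (x : S → ℝ) : Pt S :=
  Sum.elim (dual (tr μ) (dual μ x)) (dual μ x)

@[simp] theorem hull_inr (μ : S → S → ℝ) (x : S → ℝ) (t : S) : hull μ x (inr t) = dual μ x t := rfl

theorem hull_inl (μ : S → S → ℝ) (x : S → ℝ) (t : S) :
    hull μ x (inl t) = dual (tr μ) (dual μ x) t := rfl

theorem hull_inl_le {μ : S → S → ℝ} {x : S → ℝ} (hx : ∀ s, 0 ≤ x s) (s : S) :
    hull μ x (inl s) ≤ x s :=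
  dual_le_iff.2 ⟨hx s, fun t => by linarith [le_add_dual μ x s t]⟩

theorem isTight_hull (μ : S → S → ℝ) {x : S → ℝ} (hx : ∀ s, 0 ≤ x s) : IsTight μ (hull μ x) where
  nonneg w := by
    rcases w with s | s
    · exact dual_nonneg _ _ _
    · exact dual_nonneg _ _ _
  le s t := by
    have := le_add_dual (tr μ) (dual μ x) t s
    rw [hull_inl, hull_inr]
    linarith
  cov_c s := by
    rcases dual_eq_zero_or (tr μ) (dual μ x) s with h | ⟨t, h⟩
    · exact Or.inl h
    · exact Or.inr ⟨t, by rw [hull_inl, hull_inr]; linarith⟩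
  cov_r t := by
    rcases dual_eq_zero_or μ x t with h | ⟨s, h⟩
    · exact Or.inl h
    · refine Or.inr ⟨s, ?_⟩
      -- An edge tight for x stays tight, since the double dual lies below x and is still feasible.
      have h1 := hull_inl_le (μ := μ) hx s
      have h2 := le_add_dual (tr μ) (dual μ x) t s
      rw [hull_inl] at h1 ⊢
      rw [hull_inr]
      linarith

theorem dInf_hull_le (μ : S → S → ℝ) (x y : S → ℝ) : dInf (hull μ x) (hull μ y) ≤ dPlus x y := by
  have h0 := dPlus_nonneg x y
  have h := dual_le_dual_add (μ := μ) h0 (le_add_dPlus x y)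
  exact dInf_le_iff.2 ⟨h0, dual_le_dual_add h0 h, h⟩

theorem dSym_hull_le (μ : S → S → ℝ) (x y : S → ℝ) : dSym (hull μ x) (hull μ y) ≤ vSym x y :=
  add_le_add (dInf_hull_le μ x y) (dInf_hull_le μ y x)

/-- The downward flow: the `S^c`-coordinates decrease at unit speed until they vanish. -/
noncomputable def flow (μ : S → S → ℝ) (t : ℝ) (p : Pt S) : Pt S :=
  hull μ fun s => max (p (inl s) - t) 0

theorem isTight_flow (μ : S → S → ℝ) (t : ℝ) (p : Pt S) : IsTight μ (flow μ t p) :=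
  isTight_hull μ fun _ => le_max_right _ _

theorem flow_inr_le {μ : S → S → ℝ} {p : Pt S} (hp : IsTight μ p) {t : ℝ} (ht : 0 ≤ t) (v : S) :
    flow μ t p (inr v) ≤ p (inr v) + t :=
  dual_le_iff.2 ⟨add_nonneg (hp.nonneg _) ht, fun s => by
    linarith [hp.le s v, le_max_left (p (inl s) - t) 0]⟩

/-- The hull does not lower the truncated vector further: S^r rises by at most t, so by duality S^c
falls by at most t. -/
theorem flow_inl {μ : S → S → ℝ} {p : Pt S} (hp : IsTight μ p) {t : ℝ} (ht : 0 ≤ t) (s : S) :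
    flow μ t p (inl s) = max (p (inl s) - t) 0 := by
  have hT := isTight_flow μ t p
  refine le_antisymm (hull_inl_le (fun _ => le_max_right _ _) s) (max_le ?_ (hT.nonneg _))
  have := hp.inl_le hT ht (flow_inr_le hp ht) s
  linarith

theorem flow_zero {μ : S → S → ℝ} {p : Pt S} (hp : IsTight μ p) : flow μ 0 p = p :=
  (isTight_flow μ 0 p).eq_of_inl hp fun s => by
    rw [flow_inl hp le_rfl, sub_zero, max_eq_left (hp.nonneg _)]

theorem flow_flow {μ : S → S → ℝ} {p : Pt S} (hp : IsTight μ p) {a b : ℝ} (ha : 0 ≤ a)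
    (hb : 0 ≤ b) : flow μ b (flow μ a p) = flow μ (a + b) p := by
  refine (isTight_flow _ _ _).eq_of_inl (isTight_flow _ _ _) fun s => ?_
  rw [flow_inl (isTight_flow _ _ _) hb, flow_inl hp ha, flow_inl hp (add_nonneg ha hb)]
  rcases le_total (p (inl s)) a with h | h
  · rw [max_eq_right (by linarith : p (inl s) - a ≤ 0), max_eq_right (by linarith),
      max_eq_right (by linarith)]
  · rw [max_eq_left (by linarith : 0 ≤ p (inl s) - a), sub_sub]

theorem flow_inl_le {μ : S → S → ℝ} {p : Pt S} (hp : IsTight μ p) {t : ℝ} (ht : 0 ≤ t) (s : S) :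
    flow μ t p (inl s) ≤ p (inl s) := by
  rw [flow_inl hp ht]
  exact max_le (by linarith) (hp.nonneg _)

theorem le_flow_inl {μ : S → S → ℝ} {p : Pt S} (hp : IsTight μ p) {t : ℝ} (ht : 0 ≤ t) (s : S) :
    p (inl s) ≤ flow μ t p (inl s) + t := by
  rw [flow_inl hp ht]
  linarith [le_max_left (p (inl s) - t) 0]

theorem dInf_flow_le {μ : S → S → ℝ} {p : Pt S} (hp : IsTight μ p) {t : ℝ} (ht : 0 ≤ t) :
    dInf (flow μ t p) p ≤ t :=
  (isTight_flow _ _ _).dInf_le hp ht (le_flow_inl hp ht)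

theorem dSym_flow_flow_le (μ : S → S → ℝ) (p q : Pt S) (t : ℝ) :
    dSym (flow μ t p) (flow μ t q) ≤ dSym p q := by
  have h (p q : Pt S) : dInf (flow μ t p) (flow μ t q) ≤ dInf p q := by
    refine (dInf_hull_le _ _ _).trans (dPlus_le_iff.2 ⟨dInf_nonneg _ _, fun s => ?_⟩)
    refine max_le ?_ (add_nonneg (le_max_right _ _) (dInf_nonneg _ _))
    linarith [inl_le_add_dInf p q s, le_max_left (p (inl s) - t) 0]
  exact add_le_add (h p q) (h q p)

end Tight

/-! ### Points to be pushed down or up -/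

section Core

variable {S : Type*}

/-- Both coordinates of `p` at `s` vanish. -/
def ZeroAt (p : Pt S) (s : S) : Prop := p (inl s) = 0 ∧ p (inr s) = 0

@[simp] theorem zeroAt_swapPt {p : Pt S} {s : S} : ZeroAt (swapPt p) s ↔ ZeroAt p s := and_comm

/-- No node `u^c` with `u` outside the zero set of `p` is adjacent to the zero set, and all these
nodes have positive coordinate. -/
def DownFat (μ : S → S → ℝ) (p : Pt S) : Prop :=
  ∀ u, ¬ZeroAt p u → 0 < p (inl u) ∧ ∀ s, ZeroAt p s → μ u s < p (inl u)

/-- The mirror image of `DownFat`. -/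
def UpFat (μ : S → S → ℝ) (p : Pt S) : Prop :=
  ∀ u, ¬ZeroAt p u → 0 < p (inr u) ∧ ∀ s, ZeroAt p s → μ s u < p (inr u)

/-- Some `v^r` with `v` outside the zero set of `p` is adjacent to no `u^c` with `u` outside the
zero set. -/
def HasFree (μ : S → S → ℝ) (p : Pt S) : Prop :=
  ∃ v, ¬ZeroAt p v ∧ ∀ u, ¬ZeroAt p u → μ u v < p (inl u) + p (inr v)

/-- `r` arises from `p` by adding `a (𝟙, -𝟙)` outside the zero set. -/
def Shift (p r : Pt S) (a : ℝ) : Prop :=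
  (∀ s, ZeroAt p s → ZeroAt r s) ∧
    ∀ s, ¬ZeroAt p s → r (inl s) = p (inl s) + a ∧ r (inr s) = p (inr s) - a

theorem downFat_swapPt {μ : S → S → ℝ} {p : Pt S} : DownFat (tr μ) (swapPt p) ↔ UpFat μ p := by
  simp [DownFat, UpFat]

theorem upFat_swapPt {μ : S → S → ℝ} {p : Pt S} : UpFat (tr μ) (swapPt p) ↔ DownFat μ p := by
  simp [DownFat, UpFat]

theorem Shift.swap {p r : Pt S} {a : ℝ} (h : Shift p r a) : Shift (swapPt p) (swapPt r) (-a) := by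
  refine ⟨fun s hs => zeroAt_swapPt.2 (h.1 s (zeroAt_swapPt.1 hs)), fun s hs => ?_⟩
  obtain ⟨h1, h2⟩ := h.2 s (mt zeroAt_swapPt.2 hs)
  exact ⟨by simp [h2, sub_eq_add_neg], by simp [h1]⟩

theorem Shift.zeroAt_iff {μ : S → S → ℝ} {p r : Pt S} {a : ℝ} (h : Shift p r a)
    (hp : IsTight μ p) (s : S) : ZeroAt r s ↔ ZeroAt p s := by
  refine ⟨fun hr => ?_, h.1 s⟩
  by_contra hs
  obtain ⟨h1, h2⟩ := h.2 s hs
  have n1 := hp.nonneg (inl s)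
  have n2 := hp.nonneg (inr s)
  rw [hr.1] at h1
  rw [hr.2] at h2
  exact hs ⟨by linarith, by linarith⟩

theorem Shift.eq {p r : Pt S} (h : Shift p r 0) : r = p := by
  ext w
  by_cases hs : ZeroAt p (w.elim id id)
  · have := h.1 _ hs
    rcases w with s | s
    · exact this.1.trans hs.1.symm
    · exact this.2.trans hs.2.symm
  · have := h.2 _ hs
    rcases w with s | s
    · simpa using this.1
    · simpa using this.2

/-- There is room to move down: the weak inequalities valid at r are strict at p. -/
theorem Shift.downFat {μ : S → S → ℝ} {p r : Pt S} {a : ℝ} (h : Shift p r a) (hp : IsTight μ p)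
    (hr : IsTight μ r) (ha : a < 0) : DownFat μ p := by
  intro u hu
  obtain ⟨h1, -⟩ := h.2 u hu
  refine ⟨by linarith [hr.nonneg (inl u)], fun s hs => ?_⟩
  have := hr.le u s
  rw [((h.zeroAt_iff hp s).2 hs).2] at this
  linarith

theorem Shift.downFat_of_nonneg {μ : S → S → ℝ} {p r : Pt S} {a : ℝ} (h : Shift p r a)
    (hp : IsTight μ p) (hf : DownFat μ p) (ha : 0 ≤ a) : DownFat μ r := by
  intro u hu
  rw [h.zeroAt_iff hp] at hu
  obtain ⟨h1, -⟩ := h.2 u hu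
  refine ⟨by linarith [(hf u hu).1], fun s hs => ?_⟩
  linarith [(hf u hu).2 s ((h.zeroAt_iff hp s).1 hs)]

theorem Shift.upFat_of_neg {μ : S → S → ℝ} {p r : Pt S} {a : ℝ} (h : Shift p r a)
    (hp : IsTight μ p) (ha : a < 0) : UpFat μ r := by
  intro u hu
  rw [h.zeroAt_iff hp] at hu
  obtain ⟨-, h1⟩ := h.2 u hu
  refine ⟨by linarith [hp.nonneg (inr u)], fun s hs => ?_⟩
  have := hp.le s u
  rw [((h.zeroAt_iff hp s).1 hs).1] at this
  linarith

/-- The properties of a slimmed section in `(Q_μ^{slim})^+` on which the retraction is built. -/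
structure IsCore (μ : S → S → ℝ) (R : Set (Pt S)) : Prop where
  tight : ∀ p ∈ R, IsTight μ p
  covered : ∀ p ∈ R, DownFat μ p ∨ UpFat μ p → ¬HasFree μ p ∧ ¬HasFree (tr μ) (swapPt p)
  trichotomy : ∀ p, IsTight μ p → (DownFat μ p ∧ HasFree μ p) ∨
    (UpFat μ p ∧ HasFree (tr μ) (swapPt p)) ∨ ∃ r ∈ R, ∃ a, Shift p r a
  antichain : ∀ p ∈ R, ∀ q ∈ R, (∀ s, ZeroAt p s ↔ ZeroAt q s) → (∃ s, ¬ZeroAt p s) →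
    DownFat μ p ∨ UpFat μ p → DownFat μ q ∨ UpFat μ q →
    ¬(∀ s, ¬ZeroAt p s → p (inl s) < q (inl s)) ∧ ¬(∀ s, ¬ZeroAt p s → p (inr s) < q (inr s))

theorem IsCore.swap {μ : S → S → ℝ} {R : Set (Pt S)} (h : IsCore μ R) :
    IsCore (tr μ) (swapSet R) where
  tight p hp := by simpa using (h.tight _ hp).swap
  covered p hp hf := by
    have := h.covered _ hp (by
      rw [← downFat_swapPt, ← upFat_swapPt, swapPt_swapPt]
      exact hf.symm)
    rw [swapPt_swapPt] at this
    exact this.symm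
  trichotomy p hp := by
    have hp' : IsTight μ (swapPt p) := hp.swap
    rcases h.trichotomy _ hp' with ⟨h1, h2⟩ | ⟨h1, h2⟩ | ⟨r, hr, a, ha⟩
    · refine Or.inr (Or.inl ⟨?_, h2⟩)
      rwa [← upFat_swapPt, swapPt_swapPt] at h1
    · refine Or.inl ⟨?_, ?_⟩
      · rwa [← downFat_swapPt, swapPt_swapPt] at h1
      · rwa [swapPt_swapPt] at h2
    · refine Or.inr (Or.inr ⟨swapPt r, by simpa using hr, -a, ?_⟩)
      simpa using ha.swap
  antichain p hp q hq hz hne hfp hfq := by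
    have := h.antichain _ hp _ hq (by simpa using hz) (by simpa using hne)
      (by rw [← downFat_swapPt, ← upFat_swapPt, swapPt_swapPt]; exact hfp.symm)
      (by rw [← downFat_swapPt, ← upFat_swapPt, swapPt_swapPt]; exact hfq.symm)
    simp only [zeroAt_swapPt, swapPt_inl, swapPt_inr] at this
    exact this.symm

/-- The downward flow starts at `p`. -/
structure IsDown (μ : S → S → ℝ) (R : Set (Pt S)) (p : Pt S) : Prop where
  nonzero : ∃ u, ¬ZeroAt p u
  fat : DownFat μ p
  free_or : HasFree μ p ∨ ∃ r ∈ R, ∃ a > 0, Shift p r (-a)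

/-- The upward flow starts at `p`. -/
def IsUp (μ : S → S → ℝ) (R : Set (Pt S)) (p : Pt S) : Prop :=
  IsDown (tr μ) (swapSet R) (swapPt p)

theorem isUp_swap {μ : S → S → ℝ} {R : Set (Pt S)} {p : Pt S} :
    IsUp (tr μ) (swapSet R) (swapPt p) ↔ IsDown μ R p := by
  unfold IsUp
  rw [swapSet_swapSet, swapPt_swapPt]

variable {μ : S → S → ℝ} {R : Set (Pt S)}

theorem IsTight.zeroAt_of_gt {p q : Pt S} (hp : IsTight μ p) (hq : IsTight μ q)
    (h : ∀ u, ¬ZeroAt p u → 0 < q (inl u) ∧ ∀ s, ZeroAt p s → μ u s < q (inl u)) :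
    (∀ s, ZeroAt p s → q (inr s) = 0) ∧ ∀ s, ZeroAt q s → ZeroAt p s := by
  constructor
  · intro s hs
    rcases hq.cov_r s with h0 | ⟨u, hu⟩
    · exact h0
    · by_cases hpu : ZeroAt p u
      · have := hp.le u s
        rw [hpu.1, hs.2] at this
        linarith [hq.nonneg (inl u), hq.nonneg (inr s)]
      · linarith [(h u hpu).2 s hs, hq.nonneg (inr s)]
  · intro s hs
    by_contra hps
    exact (h s hps).1.ne' hs.1

/-- The common source of openness and monotonicity of `IsDown`: only strict lower bounds on the
S^c-coordinates of q are needed. The zero set can only shrink from p to q. If it shrinks, a free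
node appears; otherwise a free node of p survives, or the antichain property forces the section
point in the class of q to lie below q. -/
theorem IsCore.isDown_of_gt (hR : IsCore μ R) {p q : Pt S} (hp : IsTight μ p) (hq : IsTight μ q)
    (hd : IsDown μ R p)
    (h1 : ∀ u, ¬ZeroAt p u → 0 < q (inl u) ∧ ∀ s, ZeroAt p s → μ u s < q (inl u))
    (h2 : HasFree μ p → ∃ v, ¬ZeroAt p v ∧
      ∀ u, ¬ZeroAt p u → μ u v < p (inl u) + p (inr v) ∧ μ u v < q (inl u) + p (inr v))
    (h3 : ¬HasFree μ p → ∃ r ∈ R, ∃ a > 0, Shift p r (-a) ∧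
      ∀ u, ¬ZeroAt p u → p (inl u) - a < q (inl u)) : IsDown μ R q := by
  obtain ⟨hz, hle⟩ := hp.zeroAt_of_gt hq h1
  have null : ∀ u s, ZeroAt p u → ZeroAt p s → μ u s ≤ 0 := fun u s hu hs => by
    have := hp.le u s
    rw [hu.1, hs.2] at this
    linarith
  have hpos : ∀ u, ¬ZeroAt q u → 0 < q (inl u) := fun u hu => by
    by_cases hpu : ZeroAt p u
    · exact lt_of_le_of_ne (hq.nonneg _) fun h0 => hu ⟨h0.symm, hz u hpu⟩
    · exact (h1 u hpu).1
  have hgt : ∀ u, ¬ZeroAt q u → ∀ s, ZeroAt p s → μ u s < q (inl u) := fun u hu s hs => by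
    by_cases hpu : ZeroAt p u
    · exact (null u s hpu hs).trans_lt (hpos u hu)
    · exact (h1 u hpu).2 s hs
  have hfat : DownFat μ q := fun u hu => ⟨hpos u hu, fun s hs => hgt u hu s (hle s hs)⟩
  obtain ⟨u0, hu0⟩ := hd.nonzero
  refine ⟨⟨u0, mt (hle u0) hu0⟩, hfat, ?_⟩
  by_cases heq : ∀ s, ZeroAt p s → ZeroAt q s
  swap
  · push Not at heq
    obtain ⟨s, hs, hs'⟩ := heq
    -- The element that left the zero set is itself free.
    refine Or.inl ⟨s, hs', fun u hu => ?_⟩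
    linarith [hgt u hu s hs, hq.nonneg (inr s)]
  have hiff : ∀ s, ZeroAt q s ↔ ZeroAt p s := fun s => ⟨hle s, heq s⟩
  by_cases hfree : HasFree μ p
  · obtain ⟨v, hv, hv'⟩ := h2 hfree
    refine Or.inl ⟨v, mt (hle v) hv, fun u hu => ?_⟩
    have hpq : p (inr v) ≤ q (inr v) := by
      rcases hp.cov_r v with h0 | ⟨s, hs⟩
      · rw [h0]
        exact hq.nonneg _
      · by_cases hps : ZeroAt p s
        · have := hq.le s v
          rw [(heq s hps).1] at this
          rw [hps.1] at hs
          linarith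
        · linarith [(hv' s hps).1]
    rw [hiff] at hu
    linarith [(hv' u hu).2]
  obtain ⟨r0, hr0, a, ha, hs0, hlt⟩ := h3 hfree
  rcases hR.trichotomy q hq with ⟨-, h⟩ | ⟨-, v, hv, hv'⟩ | ⟨r, hr, b, hb⟩
  · exact Or.inl h
  -- The positive coordinate at v^c needs a tight edge, which can end neither in the zero set nor
  -- outside it.
  · exfalso
    rw [zeroAt_swapPt] at hv
    rcases hq.cov_c v with h0 | ⟨u, hu⟩
    · exact (hpos v hv).ne' h0
    · by_cases hqu : ZeroAt q u
      · have := hgt v hv u (hle u hqu)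
        rw [hqu.2] at hu
        linarith
      · have := hv' u (by simpa using hqu)
        simp only [swapPt_inl, swapPt_inr] at this
        linarith
  · rcases lt_or_ge b 0 with hb0 | hb0
    · exact Or.inr ⟨r, hr, -b, by simpa using hb0, by simpa using hb⟩
    · exfalso
      have hz0 := hs0.zeroAt_iff hp
      have hz1 := hb.zeroAt_iff hq
      -- Outside the zero set, r^c ≥ q^c > r0^c, although both r and r0 lie in R.
      refine (hR.antichain r0 hr0 r hr (fun s => by rw [hz0, hz1, hiff]) ⟨u0, by rwa [hz0]⟩
        (Or.inr (hs0.upFat_of_neg hp (by linarith)))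
        (Or.inl (hb.downFat_of_nonneg hq hfat hb0))).1 fun s hs => ?_
      rw [hz0] at hs
      rw [(hs0.2 s hs).1, (hb.2 s (by rwa [hiff])).1]
      linarith [hlt s hs]

theorem IsCore.not_mem_of_isDown (hR : IsCore μ R) {p : Pt S} (hd : IsDown μ R p) : p ∉ R := by
  intro hpR
  have hp := hR.tight p hpR
  rcases hd.free_or with h | ⟨r, hr, a, ha, hs⟩
  · exact (hR.covered p hpR (Or.inl hd.fat)).1 h
  · have hz := hs.zeroAt_iff hp
    obtain ⟨u, hu⟩ := hd.nonzero
    refine (hR.antichain r hr p hpR hz ⟨u, by rwa [hz]⟩ (Or.inr (hs.upFat_of_neg hp (by linarith)))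
      (Or.inl hd.fat)).1 fun s hs' => ?_
    rw [hz] at hs'
    rw [(hs.2 s hs').1]
    linarith

theorem IsTight.not_upFat_of_hasFree {p : Pt S} (hp : IsTight μ p) (h : HasFree μ p) :
    ¬UpFat μ p := by
  intro hf
  obtain ⟨v, hv, hv'⟩ := h
  rcases hp.cov_r v with h0 | ⟨u, hu⟩
  · exact (hf v hv).1.ne' h0
  · by_cases hpu : ZeroAt p u
    · have := (hf v hv).2 u hpu
      rw [hpu.1] at hu
      linarith
    · linarith [hv' u hpu]

theorem IsUp.fat {p : Pt S} (h : IsUp μ R p) : UpFat μ p := downFat_swapPt.1 (IsDown.fat h)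

theorem IsUp.free_or {p : Pt S} (h : IsUp μ R p) :
    HasFree (tr μ) (swapPt p) ∨ ∃ r ∈ R, ∃ a > 0, Shift p r a := by
  refine (IsDown.free_or h).imp_right ?_
  rintro ⟨r, hr, a, ha, hs⟩
  refine ⟨swapPt r, hr, a, ha, ?_⟩
  simpa using hs.swap

theorem IsCore.not_isUp_of_isDown (hR : IsCore μ R) {p : Pt S} (hp : IsTight μ p)
    (hd : IsDown μ R p) : ¬IsUp μ R p := by
  intro hu
  rcases hd.free_or with h | ⟨r, hr, a, ha, hs⟩
  · exact hp.not_upFat_of_hasFree h hu.fat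
  rcases hu.free_or with h | ⟨r', hr', a', ha', hs'⟩
  · exact hp.swap.not_upFat_of_hasFree h (upFat_swapPt.2 hd.fat)
  have hz := hs.zeroAt_iff hp
  obtain ⟨u, hu⟩ := hd.nonzero
  refine (hR.antichain r hr r' hr' (fun s => by rw [hz, hs'.zeroAt_iff hp]) ⟨u, by rwa [hz]⟩
    (Or.inr (hs.upFat_of_neg hp (by linarith)))
    (Or.inl (hs'.downFat_of_nonneg hp hd.fat ha'.le))).1 fun s h => ?_
  rw [hz] at h
  rw [(hs.2 s h).1, (hs'.2 s h).1]
  linarith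

theorem IsCore.isDown_or_isUp_or_mem (hR : IsCore μ R) {p : Pt S} (hp : IsTight μ p) :
    IsDown μ R p ∨ IsUp μ R p ∨ p ∈ R := by
  rcases hR.trichotomy p hp with ⟨h1, h2⟩ | ⟨h1, h2⟩ | ⟨r, hr, a, ha⟩
  · exact Or.inl ⟨⟨_, h2.choose_spec.1⟩, h1, Or.inl h2⟩
  · exact Or.inr (Or.inl ⟨⟨_, h2.choose_spec.1⟩, downFat_swapPt.2 h1, Or.inl h2⟩)
  by_cases hne : ∃ u, ¬ZeroAt p u
  swap
  · push Not at hne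
    have : Shift p r 0 := ⟨ha.1, fun s hs => absurd (hne s) hs⟩
    exact Or.inr (Or.inr (this.eq ▸ hr))
  rcases lt_trichotomy a 0 with h | rfl | h
  · exact Or.inl ⟨hne, ha.downFat hp (hR.tight r hr) h,
      Or.inr ⟨r, hr, -a, by simpa using h, by simpa using ha⟩⟩
  · exact Or.inr (Or.inr (ha.eq ▸ hr))
  · refine Or.inr (Or.inl ⟨by simpa using hne, ?_, Or.inr ⟨swapPt r, by simpa using hr, a, h, ?_⟩⟩)
    · exact ha.swap.downFat hp.swap (hR.tight r hr).swap (by simpa using h)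
    · exact ha.swap

/-- `IsDown` at p rests on finitely many strict inequalities; any ε below all their gaps works. -/
theorem IsCore.exists_isDown_of_gt [Finite S] (hR : IsCore μ R) {p : Pt S} (hp : IsTight μ p)
    (hd : IsDown μ R p) :
    ∃ ε > 0, ∀ q, IsTight μ q → (∀ u, p (inl u) - ε < q (inl u)) → IsDown μ R q := by
  have gap : ∀ c : ℝ, 0 < c → ∀ᶠ ε in nhdsWithin (0 : ℝ) (Set.Ioi 0), ε < c := fun c hc =>
    nhdsWithin_le_nhds (Iio_mem_nhds hc)
  have e1 : ∀ᶠ ε in nhdsWithin (0 : ℝ) (Set.Ioi 0), ∀ u, ¬ZeroAt p u → ε < p (inl u) :=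
    Filter.eventually_all.2 fun u => Filter.eventually_imp_distrib_left.2 fun hu =>
      gap _ (hd.fat u hu).1
  have e2 : ∀ᶠ ε in nhdsWithin (0 : ℝ) (Set.Ioi 0), ∀ u, ¬ZeroAt p u → ∀ s, ZeroAt p s →
      ε < p (inl u) - μ u s :=
    Filter.eventually_all.2 fun u => Filter.eventually_imp_distrib_left.2 fun hu =>
      Filter.eventually_all.2 fun s => Filter.eventually_imp_distrib_left.2 fun hs =>
        gap _ (sub_pos.2 ((hd.fat u hu).2 s hs))
  have e3 : ∀ᶠ ε in nhdsWithin (0 : ℝ) (Set.Ioi 0), HasFree μ p → ∃ v, ¬ZeroAt p v ∧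
      ∀ u, ¬ZeroAt p u → 0 < ε ∧ ε < p (inl u) + p (inr v) - μ u v :=
    Filter.eventually_imp_distrib_left.2 fun ⟨v, hv, hv'⟩ => by
      have : ∀ᶠ ε in nhdsWithin (0 : ℝ) (Set.Ioi 0), ∀ u, ¬ZeroAt p u →
          ε < p (inl u) + p (inr v) - μ u v :=
        Filter.eventually_all.2 fun u => Filter.eventually_imp_distrib_left.2 fun hu =>
          gap _ (sub_pos.2 (hv' u hu))
      filter_upwards [this, self_mem_nhdsWithin] with ε h h0
      exact ⟨v, hv, fun u hu => ⟨h0, h u hu⟩⟩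
  have e4 : ∀ᶠ ε in nhdsWithin (0 : ℝ) (Set.Ioi 0), ¬HasFree μ p →
      ∃ r ∈ R, ∃ a > 0, Shift p r (-a) ∧ ε < a :=
    Filter.eventually_imp_distrib_left.2 fun h => by
      obtain ⟨r, hr, a, ha, hs⟩ := hd.free_or.resolve_left h
      filter_upwards [gap a ha] with ε hε
      exact ⟨r, hr, a, ha, hs, hε⟩
  obtain ⟨ε, ⟨⟨⟨h1, h2⟩, h3⟩, h4⟩, h0⟩ :=
    ((((e1.and e2).and e3).and e4).and self_mem_nhdsWithin).exists
  refine ⟨ε, h0, fun q hq hpq => hR.isDown_of_gt hp hq hd (fun u hu => ?_) (fun hf => ?_)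
    (fun hf => ?_)⟩
  · exact ⟨by linarith [h1 u hu, hpq u], fun s hs => by linarith [h2 u hu s hs, hpq u]⟩
  · obtain ⟨v, hv, hv'⟩ := h3 hf
    exact ⟨v, hv, fun u hu => ⟨by linarith [(hv' u hu).1, (hv' u hu).2],
      by linarith [(hv' u hu).2, hpq u]⟩⟩
  · obtain ⟨r, hr, a, ha, hs, hlt⟩ := h4 hf
    exact ⟨r, hr, a, ha, hs, fun u _ => by linarith [hpq u]⟩

theorem IsCore.isDown_of_le [Finite S] (hR : IsCore μ R) {p q : Pt S} (hp : IsTight μ p)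
    (hq : IsTight μ q) (hd : IsDown μ R p) (h : ∀ u, p (inl u) ≤ q (inl u)) : IsDown μ R q := by
  obtain ⟨ε, h0, hε⟩ := hR.exists_isDown_of_gt hp hd
  exact hε q hq fun u => by linarith [h u]

end Core

/-! ### Landing times and the retraction onto the section -/

section Landing

variable {S : Type*} [Fintype S] {μ : S → S → ℝ} {R : Set (Pt S)}

/-- The downward flow from `p` reaches `r ∈ R` at time `a`. -/
structure LandsDown (μ : S → S → ℝ) (R : Set (Pt S)) (a : ℝ) (p r : Pt S) : Prop where
  nonneg : 0 ≤ a
  mem : r ∈ R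
  eq : r = flow μ a p
  isDown : ∀ t, 0 ≤ t → t < a → IsDown μ R (flow μ t p)

/-- The upward flow from `p` reaches `r ∈ R` at time `a`. -/
def LandsUp (μ : S → S → ℝ) (R : Set (Pt S)) (a : ℝ) (p r : Pt S) : Prop :=
  LandsDown (tr μ) (swapSet R) a (swapPt p) (swapPt r)

theorem landsDown_zero {p : Pt S} (hp : IsTight μ p) (hpR : p ∈ R) : LandsDown μ R 0 p p where
  nonneg := le_rfl
  mem := hpR
  eq := (flow_zero hp).symm
  isDown _ h0 h1 := absurd h1 h0.not_gt

/-- The landing time is the first time at which `IsDown` fails. `IsUp` cannot hold there: being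
open, it would hold slightly earlier too, where the flow is still `IsDown`. What remains is
membership in R. -/
theorem IsCore.exists_landsDown (hR : IsCore μ R) {p : Pt S} (hp : IsTight μ p)
    (hd : IsDown μ R p) : ∃ a r, LandsDown μ R a p r := by
  classical
  set A : Set ℝ := {t | 0 ≤ t ∧ ¬IsDown μ R (flow μ t p)} with hA
  have hbdd : BddBelow A := ⟨0, fun t ht => ht.1⟩
  have hne : A.Nonempty := by
    -- By this time every S^c-coordinate has reached zero, which contradicts the positivity in
    -- `DownFat`.
    refine ⟨∑ s, p (inl s), Finset.sum_nonneg fun s _ => hp.nonneg _, fun h => ?_⟩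
    obtain ⟨u, hu⟩ := h.nonzero
    have h1 := (h.fat u hu).1
    rw [flow_inl hp (Finset.sum_nonneg fun s _ => hp.nonneg _)] at h1
    have := Finset.single_le_sum (f := fun s => p (inl s)) (fun s _ => hp.nonneg _)
      (Finset.mem_univ u)
    rw [max_eq_right (by simpa using this)] at h1
    exact h1.false
  set a := sInf A with ha
  have ha0 : 0 ≤ a := le_csInf hne fun t ht => ht.1
  have hlt : ∀ t, 0 ≤ t → t < a → IsDown μ R (flow μ t p) := fun t h0 h1 => by
    by_contra h
    exact h1.not_ge (csInf_le hbdd ⟨h0, h⟩)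
  have hT := isTight_flow μ a p
  have hnd : ¬IsDown μ R (flow μ a p) := fun h => by
    obtain ⟨ε, h0, hε⟩ := hR.exists_isDown_of_gt hT h
    obtain ⟨t, ht, hta⟩ := exists_lt_of_csInf_lt hne (show sInf A < a + ε by linarith)
    refine ht.2 (hε _ (isTight_flow _ _ _) fun u => ?_)
    rw [flow_inl hp ha0, flow_inl hp ht.1]
    rcases max_cases (p (inl u) - a) 0 with h | h
    · linarith [le_max_left (p (inl u) - t) 0]
    · linarith [le_max_right (p (inl u) - t) 0]
  have hnu : ¬IsUp μ R (flow μ a p) := fun h => by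
    obtain ⟨ε, h0, hε⟩ := hR.swap.exists_isDown_of_gt hT.swap h
    have hpos : 0 < a := ha0.lt_of_ne fun h0 => hnd (by rw [← h0, flow_zero hp]; exact hd)
    obtain ⟨t, ht1, hta⟩ := exists_between (max_lt hpos (show a - ε < a by linarith))
    obtain ⟨ht0, htε⟩ := max_lt_iff.1 ht1
    refine hR.not_isUp_of_isDown (isTight_flow _ _ _) (hlt t ht0.le hta)
      (hε _ (isTight_flow _ _ _).swap fun v => ?_)
    have := flow_inr_le (isTight_flow μ t p) (sub_nonneg.2 hta.le) v
    rw [flow_flow hp ht0.le (sub_nonneg.2 hta.le), add_sub_cancel] at this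
    simp only [swapPt_inl]
    linarith
  exact ⟨a, _, ha0, ((hR.isDown_or_isUp_or_mem hT).resolve_left hnd).resolve_left hnu, rfl, hlt⟩

theorem IsCore.exists_lands (hR : IsCore μ R) {p : Pt S} (hp : IsTight μ p) :
    ∃ r a, LandsDown μ R a p r ∨ LandsUp μ R a p r := by
  rcases hR.isDown_or_isUp_or_mem hp with h | h | h
  · obtain ⟨a, r, h⟩ := hR.exists_landsDown hp h
    exact ⟨r, a, Or.inl h⟩
  · obtain ⟨a, r, h⟩ := hR.swap.exists_landsDown hp.swap h
    exact ⟨swapPt r, a, Or.inr (by simpa [LandsUp] using h)⟩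
  · exact ⟨p, 0, Or.inl (landsDown_zero hp h)⟩

/-- D_∞(·, q) grows by at most a. Before time a the flow is `IsDown` and q is not, so by upward
closedness q lies strictly below the flow in some S^c-coordinate; hence D_∞(q, p) ≥ t for all t < a,
and D_∞(q, ·) drops by a. -/
theorem LandsDown.dSym_le (hR : IsCore μ R) {p q r : Pt S} {a : ℝ} (h : LandsDown μ R a p r)
    (hp : IsTight μ p) (hq : IsTight μ q) (hnd : ¬IsDown μ R q) : dSym r q ≤ dSym p q := by
  have h1 : dInf r q ≤ a + dInf p q := by
    rw [h.eq]
    linarith [dInf_triangle (flow μ a p) p q, dInf_flow_le hp h.nonneg]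
  have h2 : dInf q r ≤ dInf q p - a := by
    rcases h.nonneg.eq_or_lt with h0 | h0
    · rw [h.eq, ← h0, flow_zero hp, sub_zero]
    have key : ∀ t, 0 ≤ t → t < a → dInf q r ≤ dInf q p - t := fun t ht hta => by
      have hT := isTight_flow μ t p
      obtain ⟨u, hu⟩ : ∃ u, q (inl u) < flow μ t p (inl u) := by
        by_contra hcon
        push Not at hcon
        exact hnd (hR.isDown_of_le hT hq (h.isDown t ht hta) hcon)
      have hd := inl_le_add_dInf q p
      have hpos : 0 ≤ dInf q p - t := by
        rw [flow_inl hp ht] at hu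
        rcases max_cases (p (inl u) - t) 0 with hm | hm
        · linarith [hd u]
        · linarith [hq.nonneg (inl u)]
      refine (h.eq ▸ hq.dInf_le (isTight_flow μ a p)) hpos fun s => ?_
      rw [h.eq, flow_inl hp h.nonneg]
      refine max_le ?_ (add_nonneg (hq.nonneg _) hpos)
      linarith [hd s]
    refine le_of_forall_gt_imp_ge_of_dense fun c hc => ?_
    obtain ⟨t, ht1, hta⟩ := exists_between (max_lt h0 (show dInf q p - c < a by linarith))
    obtain ⟨ht0, htc⟩ := max_lt_iff.1 ht1
    linarith [key t ht0.le hta]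
  unfold dSym
  linarith

theorem LandsUp.dSym_le (hR : IsCore μ R) {p q r : Pt S} {a : ℝ} (h : LandsUp μ R a p r)
    (hp : IsTight μ p) (hq : IsTight μ q) (hnu : ¬IsUp μ R q) : dSym r q ≤ dSym p q := by
  have := LandsDown.dSym_le hR.swap h hp.swap hq.swap hnu
  rwa [dSym_swap, dSym_swap] at this

theorem LandsDown.not_isUp (hR : IsCore μ R) {p r : Pt S} {a : ℝ} (h : LandsDown μ R a p r)
    (hp : IsTight μ p) : ¬IsUp μ R p := by
  rcases h.nonneg.eq_or_lt with h0 | h0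
  · have := h.eq
    rw [← h0, flow_zero hp] at this
    exact fun hd => hR.swap.not_mem_of_isDown hd (by simpa using this ▸ h.mem)
  · have := h.isDown 0 le_rfl h0
    rw [flow_zero hp] at this
    exact hR.not_isUp_of_isDown hp this

/-- Both points flow together until the earlier landing; then one rests in R, where `IsDown` fails,
while the other finishes. -/
theorem LandsDown.dSym_le_landsDown (hR : IsCore μ R) {p q r r' : Pt S} {a b : ℝ}
    (h : LandsDown μ R a p r) (h' : LandsDown μ R b q r') (hq : IsTight μ q)
    (hab : a ≤ b) : dSym r r' ≤ dSym p q := by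
  have hba : 0 ≤ b - a := sub_nonneg.2 hab
  have hland : LandsDown μ R (b - a) (flow μ a q) r' := by
    refine ⟨hba, h'.mem, ?_, fun t h0 ht => ?_⟩
    · rw [flow_flow hq h.nonneg hba, add_sub_cancel]
      exact h'.eq
    · rw [flow_flow hq h.nonneg h0]
      exact h'.isDown _ (add_nonneg h.nonneg h0) (by linarith)
  have h1 := hland.dSym_le hR (isTight_flow _ _ _) (hR.tight r h.mem)
    (fun hd => hR.not_mem_of_isDown hd h.mem)
  rw [dSym_comm r r']
  refine h1.trans ?_
  rw [h.eq, dSym_comm p q]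
  exact dSym_flow_flow_le _ _ _ _

theorem LandsDown.dSym_le_landsUp (hR : IsCore μ R) {p q r r' : Pt S} {a b : ℝ}
    (h : LandsDown μ R a p r) (h' : LandsUp μ R b q r') (hp : IsTight μ p) (hq : IsTight μ q) :
    dSym r r' ≤ dSym p q := by
  have hnd : ¬IsDown μ R q := by
    rw [← isUp_swap]
    exact LandsDown.not_isUp hR.swap h' hq.swap
  have hr := hR.tight r h.mem
  have hnu : ¬IsUp μ R r := (landsDown_zero hr h.mem).not_isUp hR hr
  have h2 := h'.dSym_le hR hq hr hnu
  rw [dSym_comm, dSym_comm q] at h2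
  exact h2.trans (h.dSym_le hR hp hq hnd)

theorem IsCore.dSym_le_of_lands (hR : IsCore μ R) {p q r r' : Pt S} {a b : ℝ}
    (hp : IsTight μ p) (hq : IsTight μ q)
    (h : LandsDown μ R a p r ∨ LandsUp μ R a p r)
    (h' : LandsDown μ R b q r' ∨ LandsUp μ R b q r') : dSym r r' ≤ dSym p q := by
  rcases h with h | h <;> rcases h' with h' | h'
  · rcases le_total a b with hab | hab
    · exact h.dSym_le_landsDown hR h' hq hab
    · rw [dSym_comm, dSym_comm p]
      exact h'.dSym_le_landsDown hR h hp hab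
  · exact h.dSym_le_landsUp hR h' hp hq
  · rw [dSym_comm, dSym_comm p]
    exact h'.dSym_le_landsUp hR h hq hp
  · rw [← dSym_swap, ← dSym_swap p]
    rcases le_total a b with hab | hab
    · exact LandsDown.dSym_le_landsDown hR.swap h h' hq.swap hab
    · rw [dSym_comm, dSym_comm (swapPt p)]
      exact LandsDown.dSym_le_landsDown hR.swap h' h hp.swap hab

/-- Before landing, `DownFat` at the flow point carries over to the larger S^c-coordinates of p, so
zeros of p are zeros of the flow. At landing the S^r-coordinate is zero by continuity. -/
theorem LandsDown.zeroAt {p r : Pt S} {a : ℝ} (h : LandsDown μ R a p r)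
    (hp : IsTight μ p) {s : S} (hs : ZeroAt p s) : ZeroAt r s := by
  rw [h.eq]
  rcases h.nonneg.eq_or_lt with h0 | h0
  · rwa [← h0, flow_zero hp]
  refine ⟨?_, le_antisymm ?_ ((isTight_flow _ _ _).nonneg _)⟩
  · rw [flow_inl hp h.nonneg, hs.1]
    exact max_eq_right (by linarith)
  refine le_of_forall_gt_imp_ge_of_dense fun c hc => ?_
  obtain ⟨t, ht1, hta⟩ := exists_between (max_lt h0 (show a - c < a by linarith))
  obtain ⟨ht0, htc⟩ := max_lt_iff.1 ht1
  have hd := h.isDown t ht0.le hta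
  have hle := flow_inl_le hp ht0.le
  have hz := ((isTight_flow μ t p).zeroAt_of_gt hp fun u hu =>
    ⟨(hd.fat u hu).1.trans_le (hle u),
      fun s hs => ((hd.fat u hu).2 s hs).trans_le (hle u)⟩).2 s hs
  have := flow_inr_le (isTight_flow μ t p) (sub_nonneg.2 hta.le) s
  rw [flow_flow hp ht0.le (sub_nonneg.2 hta.le), add_sub_cancel, hz.2] at this
  linarith

theorem LandsUp.zeroAt {p r : Pt S} {a : ℝ} (h : LandsUp μ R a p r)
    (hp : IsTight μ p) {s : S} (hs : ZeroAt p s) : ZeroAt r s :=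
  zeroAt_swapPt.1 (LandsDown.zeroAt h hp.swap (zeroAt_swapPt.2 hs))

theorem LandsDown.inl_le {p r : Pt S} {a : ℝ} (h : LandsDown μ R a p r) (hp : IsTight μ p)
    (s : S) : r (inl s) ≤ p (inl s) := by
  rw [h.eq]
  exact flow_inl_le hp h.nonneg s

theorem LandsUp.inr_le {p r : Pt S} {a : ℝ} (h : LandsUp μ R a p r) (hp : IsTight μ p)
    (s : S) : r (inr s) ≤ p (inr s) := LandsDown.inl_le h hp.swap s

theorem LandsUp.mem {p r : Pt S} {a : ℝ} (h : LandsUp μ R a p r) : r ∈ R := by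
  simpa using LandsDown.mem h

/-- The tight span retracts onto `R`, without expanding the symmetrized distance. -/
theorem IsCore.exists_retraction (hR : IsCore μ R) : ∃ ψ : Pt S → Pt S,
    (∀ p, IsTight μ p → ψ p ∈ R) ∧ (∀ p ∈ R, ψ p = p) ∧
    (∀ p q, IsTight μ p → IsTight μ q → dSym (ψ p) (ψ q) ≤ dSym p q) ∧
    (∀ p, IsTight μ p → ∀ s, ZeroAt p s → ZeroAt (ψ p) s) ∧
    (∀ p, IsTight μ p → ¬IsDown μ R p → ∀ s, ψ p (inr s) ≤ p (inr s)) ∧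
    ∀ p, IsTight μ p → ¬IsUp μ R p → ∀ s, ψ p (inl s) ≤ p (inl s) := by
  classical
  have hex : ∀ p, ∃ r, IsTight μ p → ∃ a, LandsDown μ R a p r ∨ LandsUp μ R a p r := fun p => by
    by_cases hp : IsTight μ p
    · obtain ⟨r, h⟩ := hR.exists_lands hp
      exact ⟨r, fun _ => h⟩
    · exact ⟨p, fun h => absurd h hp⟩
  choose ψ hψ using hex
  have hne : ∀ p q, IsTight μ p → IsTight μ q → dSym (ψ p) (ψ q) ≤ dSym p q := fun p q hp hq => by
    obtain ⟨a, ha⟩ := hψ p hp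
    obtain ⟨b, hb⟩ := hψ q hq
    exact hR.dSym_le_of_lands hp hq ha hb
  have hpos : ∀ {ν : S → S → ℝ} {Q : Set (Pt S)} {p r : Pt S} {a : ℝ},
      IsTight ν p → LandsDown ν Q a p r → ¬IsDown ν Q p → r = p := fun {ν Q p r a} hp h hd => by
    rcases h.nonneg.eq_or_lt with h0 | h0
    · rw [h.eq, ← h0, flow_zero hp]
    · exact absurd (flow_zero hp ▸ h.isDown 0 le_rfl h0) hd
  refine ⟨ψ, fun p hp => ?_, fun p hp => ?_, hne, fun p hp s hs => ?_, fun p hp hd s => ?_,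
    fun p hp hd s => ?_⟩
  · obtain ⟨a, ha | ha⟩ := hψ p hp
    · exact ha.mem
    · exact ha.mem
  · have hT := hR.tight p hp
    obtain ⟨a, ha⟩ := hψ p hT
    refine eq_of_dSym_le_zero
      ((hR.dSym_le_of_lands hT hT ha (Or.inl (landsDown_zero hT hp))).trans ?_)
    simp [dSym, dInf_self]
  · obtain ⟨a, ha | ha⟩ := hψ p hp
    · exact ha.zeroAt hp hs
    · exact ha.zeroAt hp hs
  · obtain ⟨a, ha | ha⟩ := hψ p hp
    · rw [hpos hp ha hd]
    · exact ha.inr_le hp s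
  · obtain ⟨a, ha | ha⟩ := hψ p hp
    · exact ha.inl_le hp s
    · have := hpos hp.swap ha hd
      rw [show ψ p = p by rw [← swapPt_swapPt (ψ p), this, swapPt_swapPt]]

end Landing

/-! ### Nonexpanding retracts of convex sets -/

section Geodesic

variable {S : Type*} [Fintype S]

theorem contractibleSpace_of_retract {C : Set (S → ℝ)} (hC : Convex ℝ C) (hne : C.Nonempty)
    {Z : Set (Pt S)} (ι : Pt S → S → ℝ) (f : (S → ℝ) → Pt S) (hι : ∀ p ∈ Z, ι p ∈ C)
    (hf : ∀ x ∈ C, f x ∈ Z) (hfι : ∀ p ∈ Z, f (ι p) = p)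
    (hd : ∀ p ∈ Z, ∀ q ∈ Z, vSym (ι p) (ι q) = dSym p q)
    (hle : ∀ x ∈ C, ∀ y ∈ C, dSym (f x) (f y) ≤ vSym x y) : ContractibleSpace Z := by
  have := hC.contractibleSpace hne
  let F : C(C, Z) := ⟨fun x => ⟨f x, hf x x.2⟩, by
    refine (LipschitzWith.of_dist_le_mul (K := 2) fun x y => ?_).continuous
    exact ((dist_le_dSym _ _).trans (hle x x.2 y y.2)).trans (vSym_le_two_dist _ _)⟩
  let I : C(Z, C) := ⟨fun p => ⟨ι p, hι p p.2⟩, by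
    refine (LipschitzWith.of_dist_le_mul (K := 2) fun p q => ?_).continuous
    refine (dist_le_vSym _ _).trans ?_
    rw [hd p p.2 q q.2]
    have h1 := dInf_le_dist (p : Pt S) q
    have h2 := dInf_le_dist (q : Pt S) p
    rw [dist_comm] at h2
    change dSym (p : Pt S) q ≤ 2 * dist (p : Pt S) q
    unfold dSym
    linarith⟩
  have hid : F.comp I = ContinuousMap.id Z := by
    ext1 p
    exact Subtype.ext (hfι p p.2)
  refine (contractible_iff_id_nullhomotopic Z).2 ?_
  rw [← hid]
  exact ((id_nullhomotopic C).comp_left I).comp_right F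

theorem isGeodesic_of_retract {C : Set (S → ℝ)} (hC : Convex ℝ C)
    {Z : Set (Pt S)} (ι : Pt S → S → ℝ) (f : (S → ℝ) → Pt S) (hι : ∀ p ∈ Z, ι p ∈ C)
    (hf : ∀ x ∈ C, f x ∈ Z) (hfι : ∀ p ∈ Z, f (ι p) = p)
    (hd : ∀ p ∈ Z, ∀ q ∈ Z, vSym (ι p) (ι q) = dSym p q)
    (hle : ∀ x ∈ C, ∀ y ∈ C, dSym (f x) (f y) ≤ vSym x y) : IsGeodesic Z := by
  intro p hp q hq hpq
  let seg : ℝ → S → ℝ := fun t s => ι p s + t * (ι q s - ι p s)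
  have hseg : ∀ t : unitInterval, seg t ∈ C := fun t => by
    have := hC.add_smul_sub_mem (hι p hp) (hι q hq) t.2
    exact this
  have hvseg : ∀ a b : ℝ, vSym (seg a) (seg b) = |b - a| * vSym (ι p) (ι q) := by
    have aux : ∀ a b : ℝ, a ≤ b → vSym (seg a) (seg b) = (b - a) * vSym (ι p) (ι q) := by
      intro a b hab
      have hba := sub_nonneg.2 hab
      have h1 := dPlus_mul_sub (ι p) (fun s => ι q s - ι p s) hba a
      -- With this base point and the reversed direction, parameters a and b give `seg b` and `seg
      -- a`.
      have h2 := dPlus_mul_sub (fun s => ι p s + (a + b) * (ι q s - ι p s))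
        (fun s => ι p s - ι q s) hba a
      have h3 := dPlus_mul_sub (ι p) (fun s => ι q s - ι p s) zero_le_one 0
      have h4 := dPlus_mul_sub (ι q) (fun s => ι p s - ι q s) zero_le_one 0
      have e1 : dPlus (seg a) (seg b) = (b - a) * dPlus 0 (fun s => ι q s - ι p s) := by
        rw [← h1]
        congr 1
        ext s
        simp only [seg]
        ring
      have e2 : dPlus (seg b) (seg a) = (b - a) * dPlus 0 (fun s => ι p s - ι q s) := by
        rw [← h2]
        congr 1 <;> ext s <;> simp only [seg] <;> ring
      have e3 : dPlus (ι p) (ι q) = dPlus 0 (fun s => ι q s - ι p s) := by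
        rw [one_mul] at h3
        rw [← h3]
        congr 1 <;> ext s <;> ring
      have e4 : dPlus (ι q) (ι p) = dPlus 0 (fun s => ι p s - ι q s) := by
        rw [one_mul] at h4
        rw [← h4]
        congr 1 <;> ext s <;> ring
      unfold vSym
      rw [e1, e2, e3, e4]
      ring
    intro a b
    rcases le_total a b with h | h
    · rw [aux a b h, abs_of_nonneg (sub_nonneg.2 h)]
    · rw [show vSym (seg a) (seg b) = vSym (seg b) (seg a) from add_comm _ _, aux b a h,
        abs_of_nonpos (sub_nonpos.2 h), neg_sub]
  set L := dSym p q with hL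
  have hL0 : 0 < L := lt_of_not_ge fun h => hpq (eq_of_dSym_le_zero h)
  have hbound : ∀ a b : unitInterval, dSym (f (seg a)) (f (seg b)) ≤ |(b : ℝ) - a| * L :=
    fun a b => by
      rw [hL, ← hd p hp q hq, ← hvseg]
      exact hle _ (hseg a) _ (hseg b)
  have hs0 : f (seg 0) = p := by
    rw [← hfι p hp]
    congr 1
    ext s
    simp [seg]
  have hs1 : f (seg 1) = q := by
    rw [← hfι q hq]
    congr 1
    ext s
    simp [seg]
  have hadd : ∀ a b : unitInterval, a ≤ b → dInf p (f (seg a)) + dInf (f (seg a)) (f (seg b)) =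
      dInf p (f (seg b)) ∧ dSym (f (seg a)) (f (seg b)) = (b - a) * L := by
    intro a b hab
    have hab' : (a : ℝ) ≤ b := hab
    have b1 := hbound 0 a
    have b2 := hbound a b
    have b3 := hbound b 1
    simp only [Set.Icc.coe_zero, Set.Icc.coe_one, hs0, hs1, sub_zero] at b1 b3
    rw [abs_of_nonneg a.2.1] at b1
    rw [abs_of_nonneg (sub_nonneg.2 hab')] at b2
    rw [abs_of_nonneg (sub_nonneg.2 b.2.2)] at b3
    have t1 := dInf_triangle p (f (seg a)) (f (seg b))
    have t2 := dInf_triangle p (f (seg b)) q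
    have t3 := dInf_triangle (f (seg b)) (f (seg a)) p
    have t4 := dInf_triangle q (f (seg b)) p
    -- The triangle inequalities, summed over both directions, give the reverse bound, so each of
    -- them is an equality.
    have hsum : dSym p (f (seg a)) + dSym (f (seg a)) (f (seg b)) + dSym (f (seg b)) q ≤ L := by
      nlinarith
    unfold dSym at *
    constructor
    · linarith
    · nlinarith
  refine ⟨fun t => f (seg t), ?_, ?_, fun t => hf _ (hseg t), by simpa using hs0,
    by simpa using hs1, ?_⟩
  · refine (LipschitzWith.of_dist_le_mul (K := ⟨L, hL0.le⟩) fun a b => ?_).continuous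
    refine (dist_le_dSym _ _).trans ((hbound a b).trans_eq ?_)
    rw [Subtype.dist_eq, Real.dist_eq, abs_sub_comm, mul_comm]
    rfl
  · have aux : ∀ a b : unitInterval, a ≤ b → f (seg a) = f (seg b) → a = b := fun a b hab h => by
      have h2 := (hadd a b hab).2
      rw [h] at h2
      simp only [dSym, dInf_self, add_zero] at h2
      have : (b : ℝ) - a = 0 := by
        rcases mul_eq_zero.1 h2.symm with h | h
        · exact h
        · exact absurd h hL0.ne'
      exact Subtype.ext (by linarith)
    intro a b h
    rcases le_total a b with hab | hab
    · exact aux a b hab h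
    · exact (aux b a hab h.symm).symm
  · have hpart : ∀ (n : ℕ) (t : Fin (n + 1) → unitInterval), StrictMono t → t 0 = 0 →
        t (Fin.last n) = 1 →
        ∑ i : Fin n, dInf (f (seg (t i.castSucc))) (f (seg (t i.succ))) = dInf p q := by
      intro n t ht h0 h1
      have : ∀ i : Fin n, dInf (f (seg (t i.castSucc))) (f (seg (t i.succ))) =
          dInf p (f (seg (t i.succ))) - dInf p (f (seg (t i.castSucc))) := fun i => by
        have := (hadd _ _ (ht (Fin.castSucc_lt_succ (i := i))).le).1
        linarith
      rw [Finset.sum_congr rfl fun i _ => this i, Finset.sum_sub_distrib]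
      have e1 := Fin.sum_univ_succ fun i => dInf p (f (seg (t i)))
      have e2 := Fin.sum_univ_castSucc fun i => dInf p (f (seg (t i)))
      rw [h0] at e1
      rw [h1] at e2
      simp only [Set.Icc.coe_zero, Set.Icc.coe_one, hs0, hs1, dInf_self] at e1 e2
      linarith
    constructor
    · rintro x ⟨n, -, t, ht, h0, h1, rfl⟩
      exact (hpart n t ht h0 h1).le
    · intro x hx
      refine hx ⟨1, one_pos, ![0, 1], ?_, rfl, rfl, ?_⟩
      · intro i j hij
        fin_cases i <;> fin_cases j <;> simp at hij ⊢
      · refine (hpart 1 ![0, 1] ?_ rfl rfl).symm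
        intro i j hij
        fin_cases i <;> fin_cases j <;> simp at hij ⊢

end Geodesic

/-! ### Fats and degenerate sets in terms of tight points -/

section Slim

variable {S : Type*} {μ : S → S → ℝ}

@[simp] theorem K_adj_inl_inr {p : Pt S} {s t : S} :
    (K μ p).Adj (inl s) (inr t) ↔ p (inl s) + p (inr t) = μ s t := by
  simp [K, SimpleGraph.fromRel_adj]

@[simp] theorem K_adj_inr_inl {p : Pt S} {s t : S} :
    (K μ p).Adj (inr t) (inl s) ↔ p (inl s) + p (inr t) = μ s t := by
  rw [SimpleGraph.adj_comm, K_adj_inl_inr]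

@[simp] theorem not_K_adj_inl_inl {p : Pt S} {s t : S} : ¬(K μ p).Adj (inl s) (inl t) := by
  simp [K, SimpleGraph.fromRel_adj]

@[simp] theorem not_K_adj_inr_inr {p : Pt S} {s t : S} : ¬(K μ p).Adj (inr s) (inr t) := by
  simp [K, SimpleGraph.fromRel_adj]

theorem inr_mem_N {p : Pt S} {Y : Set S} {v : S} :
    inr v ∈ N μ p (inl '' Y) ↔ ∃ u ∈ Y, p (inl u) + p (inr v) = μ u v := by
  simp [N]

theorem inl_mem_N {p : Pt S} {Y : Set S} {v : S} :
    inl v ∈ N μ p (inr '' Y) ↔ ∃ u ∈ Y, p (inl v) + p (inr u) = μ v u := by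
  simp [N]

theorem inl_notMem_N {p : Pt S} {Y : Set S} {v : S} : inl v ∉ N μ p (inl '' Y) := by
  simp [N]

theorem inr_notMem_N {p : Pt S} {Y : Set S} {v : S} : inr v ∉ N μ p (inr '' Y) := by
  simp [N]

theorem swapPt_mem_Q {p : Pt S} (hp : p ∈ Q μ) : swapPt p ∈ Q (tr μ) := by
  have hsw : ∀ {ν : S → S → ℝ} {y : Pt S}, y ∈ P ν → swapPt y ∈ P (tr ν) := fun hy s t => by
    simpa [add_comm] using hy t s
  refine ⟨hsw hp.1, fun y hy hle => ?_⟩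
  have := hp.2 (hsw hy) fun w => by simpa [swapPt] using hle w.swap
  intro w
  simpa [swapPt] using this w.swap

theorem exists_edge_of_mem_Q [Finite S] {p : Pt S} (hp : p ∈ Q μ) (u : S) :
    ∃ t, p (inl u) + p (inr t) = μ u t := by
  classical
  by_contra hcon
  push Not at hcon
  have : Nonempty S := ⟨u⟩
  obtain ⟨t0, ht0⟩ := Finite.exists_min fun t => p (inl u) + p (inr t) - μ u t
  set ε := p (inl u) + p (inr t0) - μ u t0 with hε
  have hpos : 0 < ε := sub_pos.2 (lt_of_le_of_ne (hp.1 u t0) (hcon t0).symm)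
  have hP : Function.update p (inl u) (p (inl u) - ε) ∈ P μ := fun s t => by
    rw [Function.update_of_ne (by simp : (inr t : S ⊕ S) ≠ inl u)]
    by_cases hs : s = u
    · subst hs
      rw [Function.update_self]
      linarith [ht0 t]
    · rw [Function.update_of_ne (by simpa using hs)]
      exact hp.1 s t
  have := hp.2 hP (update_le_self_iff.2 (by linarith)) (inl u)
  rw [Function.update_self] at this
  linarith

theorem exists_edge_of_mem_Q' [Finite S] {p : Pt S} (hp : p ∈ Q μ) (v : S) :
    ∃ s, p (inl s) + p (inr v) = μ s v := by
  simpa [add_comm] using exists_edge_of_mem_Q (swapPt_mem_Q hp) v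

theorem mem_Q_of_edges {p : Pt S} (hp : p ∈ P μ)
    (hc : ∀ s, ∃ t, p (inl s) + p (inr t) = μ s t)
    (hr : ∀ t, ∃ s, p (inl s) + p (inr t) = μ s t) : p ∈ Q μ := by
  refine ⟨hp, fun y hy hle w => ?_⟩
  rcases w with s | t
  · obtain ⟨t, ht⟩ := hc s
    linarith [hy s t, hle (inr t)]
  · obtain ⟨s, hs⟩ := hr t
    linarith [hy s t, hle (inl s)]

theorem isTight_of_mem_Q [Finite S] {p : Pt S} (hp : p ∈ Q μ) (h0 : ∀ w, 0 ≤ p w) :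
    IsTight μ p where
  nonneg := h0
  le := hp.1
  cov_c s := Or.inr (exists_edge_of_mem_Q hp s)
  cov_r s := Or.inr (exists_edge_of_mem_Q' hp s)

theorem zeroAt_iff_add_eq_zero {p : Pt S} (h0 : ∀ w, 0 ≤ p w) {s : S} :
    ZeroAt p s ↔ p (inl s) + p (inr s) = 0 :=
  (add_eq_zero_iff_of_nonneg (h0 _) (h0 _)).symm

theorem mem_QX_zeroAt (hμ : IsDirectedDistance μ) {p : Pt S} (hp : p ∈ Q μ) (h0 : ∀ w, 0 ≤ p w) :
    p ∈ QX μ {s | ZeroAt p s} :=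
  ⟨hp, fun s => by
    rw [K_adj_inl_inr, hμ.diag, Set.mem_ofPred_eq, zeroAt_iff_add_eq_zero h0]⟩

theorem isNull_zeroAt (hμ : IsDirectedDistance μ) {p : Pt S} (hp : p ∈ Q μ) :
    IsNull μ {s | ZeroAt p s} := fun s hs t ht => by
  have := hp.1 s t
  rw [hs.1, ht.2] at this
  exact le_antisymm (by linarith) (hμ.nonneg s t)

theorem eq_zeroAt_of_mem_QX (hμ : IsDirectedDistance μ) {p : Pt S} (h0 : ∀ w, 0 ≤ p w) {Y : Set S}
    (hp : p ∈ QX μ Y) : Y = {s | ZeroAt p s} := by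
  ext s
  rw [← hp.2 s, ← (mem_QX_zeroAt hμ hp.1 h0).2 s]

theorem mem_Qdeg_of_fat (hμ : IsDirectedDistance μ) {p : Pt S} (hp : p ∈ Qslim μ)
    (h0 : ∀ w, 0 ≤ p w) (hf : DownFat μ p ∨ UpFat μ p) : p ∈ Qdeg μ {s | ZeroAt p s} := by
  have hX := mem_QX_zeroAt hμ hp.1 h0
  have hfat : IsFatRel μ {s | ZeroAt p s} p := by
    refine ⟨hX, hf.imp (fun hf => ?_) fun hf => ?_⟩
    · rintro (v | v) hv
      · exact absurd hv inl_notMem_N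
      · obtain ⟨u, hu, he⟩ := inr_mem_N.1 hv
        refine ⟨v, fun hz => ?_, rfl⟩
        have := (hf u hu).2 v hz
        rw [(show ZeroAt p v from hz).2] at he
        linarith
    · rintro (v | v) hv
      · obtain ⟨u, hu, he⟩ := inl_mem_N.1 hv
        refine ⟨v, fun hz => ?_, rfl⟩
        have := (hf u hu).2 v hz
        rw [(show ZeroAt p v from hz).1] at he
        linarith
      · exact absurd hv inr_notMem_N
  obtain ⟨Y, -, hY⟩ : ∃ X, IsNull μ X ∧ p ∈ Qdeg μ X := by
    by_contra h
    exact hp.2 ⟨⟨_, isNull_zeroAt hμ hp.1, hfat⟩, h⟩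
  rwa [eq_zeroAt_of_mem_QX hμ h0 hY.1] at hY

theorem not_hasFree_of_mem_Qdeg [Finite S] {p : Pt S} (hp : p ∈ Qdeg μ {s | ZeroAt p s}) :
    ¬HasFree μ p ∧ ¬HasFree (tr μ) (swapPt p) := by
  constructor
  · rintro ⟨v, hv, hv'⟩
    rcases hp.2 with h | h
    · have : inr v ∈ N μ p (inl '' {s | ZeroAt p s}ᶜ) := h ▸ ⟨v, hv, rfl⟩
      obtain ⟨u, hu, he⟩ := inr_mem_N.1 this
      exact (hv' u hu).ne' he
    · obtain ⟨u, hu⟩ := exists_edge_of_mem_Q' hp.1.1 v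
      have : inl u ∈ N μ p (inr '' {s | ZeroAt p s}ᶜ) := inl_mem_N.2 ⟨v, hv, hu⟩
      rw [h] at this
      obtain ⟨u', hu', he⟩ := this
      cases he
      exact (hv' u hu').ne' hu
  · rintro ⟨v, hv, hv'⟩
    simp only [zeroAt_swapPt, swapPt_inl, swapPt_inr] at hv hv'
    rcases hp.2 with h | h
    · obtain ⟨u, hu⟩ := exists_edge_of_mem_Q hp.1.1 v
      have : inr u ∈ N μ p (inl '' {s | ZeroAt p s}ᶜ) := inr_mem_N.2 ⟨v, hv, hu⟩
      rw [h] at this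
      obtain ⟨u', hu', he⟩ := this
      cases he
      linarith [hv' u hu']
    · have : inl v ∈ N μ p (inr '' {s | ZeroAt p s}ᶜ) := h ▸ ⟨v, hv, rfl⟩
      obtain ⟨u, hu, he⟩ := inl_mem_N.1 this
      linarith [hv' u hu]

theorem fat_and_hasFree_of_not_mem_Qslim (hμ : IsDirectedDistance μ) {p : Pt S} (hp : p ∈ Q μ)
    (h0 : ∀ w, 0 ≤ p w) (hz : ∃ s, ZeroAt p s) (hns : p ∉ Qslim μ) :
    (DownFat μ p ∧ HasFree μ p) ∨ (UpFat μ p ∧ HasFree (tr μ) (swapPt p)) := by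
  obtain ⟨s0, hs0⟩ := hz
  have hpf : IsProperFat μ p := by
    by_contra h
    exact hns ⟨hp, h⟩
  obtain ⟨⟨X, hX, hfX, hf⟩, hnd⟩ := hpf
  have hXe := eq_zeroAt_of_mem_QX hμ h0 hfX
  refine hf.imp (fun hf => ?_) fun hf => ?_
  · have hlt : ∀ u, ¬ZeroAt p u → ∀ s, ZeroAt p s → μ u s < p (inl u) := fun u hu s hs => by
      have h1 := hp.1 u s
      refine lt_of_le_of_ne (by rwa [hs.2, add_zero] at h1) fun he => ?_
      have : inr s ∈ N μ p (inl '' Xᶜ) :=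
        inr_mem_N.2 ⟨u, by rw [hXe]; exact hu, by rw [hs.2, he, add_zero]⟩
      obtain ⟨s', hs', he'⟩ := hf this
      cases he'
      rw [hXe] at hs'
      exact hs' hs
    refine ⟨fun u hu => ⟨(hμ.nonneg u s0).trans_lt (hlt u hu s0 hs0), hlt u hu⟩, ?_⟩
    by_contra hfree
    refine hnd ⟨X, hX, hfX, Or.inl (hf.antisymm ?_)⟩
    rintro _ ⟨v, hv, rfl⟩
    rw [hXe] at hv
    by_contra hvN
    refine hfree ⟨v, hv, fun u hu => lt_of_le_of_ne (hp.1 u v) fun he => hvN ?_⟩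
    exact inr_mem_N.2 ⟨u, by rw [hXe]; exact hu, he.symm⟩
  · have hlt : ∀ u, ¬ZeroAt p u → ∀ s, ZeroAt p s → μ s u < p (inr u) := fun u hu s hs => by
      have h1 := hp.1 s u
      refine lt_of_le_of_ne (by rwa [hs.1, zero_add] at h1) fun he => ?_
      have : inl s ∈ N μ p (inr '' Xᶜ) :=
        inl_mem_N.2 ⟨u, by rw [hXe]; exact hu, by rw [hs.1, he, zero_add]⟩
      obtain ⟨s', hs', he'⟩ := hf this
      cases he'
      rw [hXe] at hs'
      exact hs' hs
    refine ⟨fun u hu => ⟨(hμ.nonneg s0 u).trans_lt (hlt u hu s0 hs0), hlt u hu⟩, ?_⟩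
    by_contra hfree
    refine hnd ⟨X, hX, hfX, Or.inr (hf.antisymm ?_)⟩
    rintro _ ⟨v, hv, rfl⟩
    rw [hXe] at hv
    by_contra hvN
    refine hfree ⟨v, by simpa using hv, fun u hu => ?_⟩
    rw [zeroAt_swapPt] at hu
    rw [swapPt_inl, swapPt_inr, add_comm]
    refine lt_of_le_of_ne (hp.1 v u) fun he => hvN ?_
    exact inl_mem_N.2 ⟨u, by rw [hXe]; exact hu, he.symm⟩

/-- On the zero set of p the difference is (c, -c) for some c; nonnegativity of r forces c = 0
there, leaving one parameter outside it. -/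
theorem exists_shift_of_slimRel (hμ : IsDirectedDistance μ) {p r : Pt S} (hp : ∀ w, 0 ≤ p w)
    (hr : ∀ w, 0 ≤ r w) (h : SlimRel μ p r) : ∃ a, Shift p r a := by
  obtain ⟨a, b, hab⟩ : ∃ a b : ℝ, ∀ s,
      (ZeroAt p s → p (inl s) - r (inl s) = a + b ∧ p (inr s) - r (inr s) = -(a + b)) ∧
      (¬ZeroAt p s → p (inl s) - r (inl s) = a ∧ p (inr s) - r (inr s) = -a) := by
    rcases h with h | ⟨X, -, hpX, -, h⟩
    · obtain ⟨a, h1, h2⟩ := mem_diagLine.1 h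
      refine ⟨a, 0, fun s => ⟨fun _ => ?_, fun _ => ⟨h1 s, h2 s⟩⟩⟩
      rw [add_zero]
      exact ⟨h1 s, h2 s⟩
    · obtain ⟨y, hy, z, hz, hyz⟩ := Submodule.mem_sup.1 h
      obtain ⟨a, h1, h2⟩ := mem_diagLine.1 hy
      obtain ⟨b, rfl⟩ := Submodule.mem_span_singleton.1 hz
      have hX := eq_zeroAt_of_mem_QX hμ hp hpX.1
      have hc := fun s => congrFun hyz (inl s)
      have hd := fun s => congrFun hyz (inr s)
      simp only [Pi.add_apply, Pi.sub_apply, Pi.smul_apply, dirVec, Sum.elim_inl, Sum.elim_inr,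
        smul_eq_mul, h1, h2] at hc hd
      refine ⟨a, b, fun s => ⟨fun hs => ?_, fun hs => ?_⟩⟩
      · have hs' : s ∈ X := by rw [hX]; exact hs
        rw [← hc, ← hd, Set.indicator_of_mem hs']
        constructor <;> ring
      · have hs' : s ∉ X := by rw [hX]; exact hs
        rw [← hc, ← hd, Set.indicator_of_notMem hs']
        constructor <;> ring
  refine ⟨-a, fun s hs => ?_, fun s hs => ?_⟩
  · obtain ⟨h1, h2⟩ := (hab s).1 hs
    rw [hs.1] at h1
    rw [hs.2] at h2
    have n1 := hr (inl s)
    have n2 := hr (inr s)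
    exact ⟨by linarith, by linarith⟩
  · obtain ⟨h1, h2⟩ := (hab s).2 hs
    exact ⟨by linarith, by linarith⟩

theorem IsSection.exists_slimRel {R : Set (Pt S)} (hR : IsSection μ R) {p : Pt S}
    (hp : p ∈ Qslim μ) : ∃ r ∈ R, SlimRel μ p r := by
  obtain ⟨r, hr⟩ := hR.bijective.2 (Quotient.mk (slimSetoid μ) ⟨p, hp⟩)
  exact ⟨r, r.2, (slimRel_equivalence μ).symm (Quotient.exact hr)⟩

theorem IsSlimmedSectionPos.isCore [Finite S] [Nonempty S] (hμ : IsDirectedDistance μ)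
    {R : Set (Pt S)} (hR : IsSlimmedSectionPos μ R) : IsCore μ R where
  tight p hp := isTight_of_mem_Q (hR.subset_nonneg hp).1.1 (hR.subset_nonneg hp).2
  covered p hp hf :=
    not_hasFree_of_mem_Qdeg (mem_Qdeg_of_fat hμ (hR.subset_nonneg hp).1 (hR.subset_nonneg hp).2 hf)
  trichotomy p hp := by
    have of_slim : p ∈ Qslim μ → ∃ r ∈ R, ∃ a, Shift p r a := fun h => by
      obtain ⟨r, hr, hpr⟩ := hR.isSection.exists_slimRel h
      exact ⟨r, hr, exists_shift_of_slimRel hμ hp.nonneg (hR.subset_nonneg hr).2 hpr⟩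
    by_cases hz : ∃ s, ZeroAt p s
    · have hQ : p ∈ Q μ := by
        obtain ⟨s, hs⟩ := hz
        refine mem_Q_of_edges hp.le (fun u => (hp.cov_c u).elim (fun h0 => ⟨s, ?_⟩) id)
          fun u => (hp.cov_r u).elim (fun h0 => ⟨s, ?_⟩) id
        · refine le_antisymm ?_ (hp.le u s)
          rw [h0, hs.2, add_zero]
          exact hμ.nonneg _ _
        · refine le_antisymm ?_ (hp.le s u)
          rw [h0, hs.1, add_zero]
          exact hμ.nonneg _ _
      by_cases hs : p ∈ Qslim μ
      · exact Or.inr (Or.inr (of_slim hs))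
      · rw [← or_assoc]
        exact Or.inl (fat_and_hasFree_of_not_mem_Qslim hμ hQ hp.nonneg hz hs)
    push Not at hz
    by_cases hr : ∀ v, ∃ u, p (inl u) + p (inr v) = μ u v
    swap
    · push Not at hr
      obtain ⟨v, hv⟩ := hr
      have h0 := (hp.cov_r v).resolve_right fun ⟨u, hu⟩ => hv u hu
      -- The uncovered node v^r has coordinate zero; it is free and makes every S^c-coordinate
      -- positive.
      have hlt : ∀ u, μ u v < p (inl u) + p (inr v) := fun u =>
        lt_of_le_of_ne (hp.le u v) (hv u).symm
      refine Or.inl ⟨fun u _ => ⟨?_, fun s hs => absurd hs (hz s)⟩, v, hz v, fun u _ => hlt u⟩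
      have := hlt u
      rw [h0, add_zero] at this
      exact (hμ.nonneg _ _).trans_lt this
    by_cases hc : ∀ u, ∃ v, p (inl u) + p (inr v) = μ u v
    swap
    · push Not at hc
      obtain ⟨u, hu⟩ := hc
      have h0 := (hp.cov_c u).resolve_right fun ⟨v, hv⟩ => hu v hv
      have hlt : ∀ v, μ u v < p (inl u) + p (inr v) := fun v =>
        lt_of_le_of_ne (hp.le u v) (hu v).symm
      refine Or.inr (Or.inl ⟨fun v _ => ⟨?_, fun s hs => absurd hs (hz s)⟩, u, by simpa using hz u,
        fun v _ => by simpa [add_comm] using hlt v⟩)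
      have := hlt v
      rw [h0, zero_add] at this
      exact (hμ.nonneg _ _).trans_lt this
    have hQ : p ∈ Q μ := mem_Q_of_edges hp.le hc hr
    have hX : {s | ZeroAt p s} = ∅ := Set.eq_empty_of_forall_notMem hz
    -- With empty zero set, every point of Q_μ is degenerate, hence no proper fat.
    refine Or.inr (Or.inr (of_slim ⟨hQ, fun h => h.2 ⟨∅, ?_, ?_, Or.inl ?_⟩⟩))
    · exact hX ▸ isNull_zeroAt hμ hQ
    · exact hX ▸ mem_QX_zeroAt hμ hQ hp.nonneg
    · ext w
      rcases w with v | v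
      · exact iff_of_false inl_notMem_N (by simp)
      · exact iff_of_true (inr_mem_N.2 (by simpa using hr v)) (by simp)
  antichain p hp q hq hz hne hfp hfq := by
    have h1 := mem_Qdeg_of_fat hμ (hR.subset_nonneg hp).1 (hR.subset_nonneg hp).2 hfp
    have h2 := mem_Qdeg_of_fat hμ (hR.subset_nonneg hq).1 (hR.subset_nonneg hq).2 hfq
    have he : {s | ZeroAt q s} = {s | ZeroAt p s} := Set.ext fun s => (hz s).symm
    rw [he] at h2
    have hX : {s | ZeroAt p s} ≠ Set.univ := fun h => by
      obtain ⟨s, hs⟩ := hne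
      exact hs (h ▸ Set.mem_univ s : s ∈ {s | ZeroAt p s})
    have := hR.deg_balanced _ (isNull_zeroAt hμ h1.1.1) hX
    refine ⟨fun h => this ?_, fun h => this ?_⟩
    · exact ⟨p, ⟨hp, h1, (hR.subset_nonneg hp).2⟩, q, ⟨hq, h2, (hR.subset_nonneg hq).2⟩, Or.inl h⟩
    · exact ⟨p, ⟨hp, h1, (hR.subset_nonneg hp).2⟩, q, ⟨hq, h2, (hR.subset_nonneg hq).2⟩, Or.inr h⟩

theorem exists_sub_mem_of_mkQ_image_eq {R R' : Set (Pt S)}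
    (h : (diagLine S).mkQ '' R = (diagLine S).mkQ '' R') {p : Pt S} (hp : p ∈ R) :
    ∃ p' ∈ R', p - p' ∈ diagLine S := by
  obtain ⟨p', hp', he⟩ := h ▸ Set.mem_image_of_mem (diagLine S).mkQ hp
  refine ⟨p', hp', ?_⟩
  rw [← neg_sub]
  exact neg_mem ((Submodule.Quotient.eq _).1 he)

end Slim

/-! ### Transfer to balanced sections and the distance formula -/

section Main

variable {S : Type*} [Fintype S] {μ : S → S → ℝ}

/-- Shifts by a and b change the directed distances by b - a and a - b, which cancel. Truncation at
zero does no harm: a negative bound would make q^c < p^c or p^c < q^c, against balance. -/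
theorem IsBalanced.dSym_le {R : Set (Pt S)} (hR : IsBalanced R) {p q p' q' : Pt S} (hp : p ∈ R)
    (hq : q ∈ R) (hpp : p - p' ∈ diagLine S) (hqq : q - q' ∈ diagLine S) :
    dSym p q ≤ dSym p' q' := by
  obtain ⟨a, a1, a2⟩ := mem_diagLine.1 hpp
  obtain ⟨b, b1, b2⟩ := mem_diagLine.1 hqq
  simp only [Pi.sub_apply] at a1 a2 b1 b2
  have key : ∀ {p q p' q' : Pt S} {a b : ℝ}, p ∈ R → q ∈ R →
      (∀ s, p (inl s) - p' (inl s) = a) → (∀ s, p (inr s) - p' (inr s) = -a) →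
      (∀ s, q (inl s) - q' (inl s) = b) → (∀ s, q (inr s) - q' (inr s) = -b) →
      dInf p q ≤ dInf p' q' + b - a := by
    intro p q p' q' a b hp hq a1 a2 b1 b2
    have h1 := inl_le_add_dInf p' q'
    have h2 := inr_le_add_dInf p' q'
    refine dInf_le_iff.2 ⟨?_, fun s => ?_, fun s => ?_⟩
    · by_contra hneg
      exact hR ⟨q, hq, p, hp, Or.inl fun s => by linarith [h1 s, a1 s, b1 s]⟩
    · linarith [h1 s, a1 s, b1 s]
    · linarith [h2 s, a2 s, b2 s]
  have e1 := key hp hq a1 a2 b1 b2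
  have e2 := key hq hp b1 b2 a1 a2
  unfold dSym
  linarith

theorem zeroAt_hull {x : S → ℝ} (hx : ∀ u, 0 ≤ x u) {s : S} (hs : x s ≤ 0)
    (h : ∀ u, μ u s ≤ x u) : ZeroAt (hull μ x) s := by
  have hT := isTight_hull μ hx
  refine ⟨le_antisymm ((hull_inl_le hx s).trans hs) (hT.nonneg _),
    le_antisymm ?_ (hT.nonneg _)⟩
  exact dual_le_iff.2 ⟨le_rfl, fun u => by simpa using h u⟩

theorem IsTight.hull_eq {p : Pt S} (hp : IsTight μ p) : hull μ (fun s => p (inl s)) = p := by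
  have := flow_zero hp
  unfold flow at this
  simpa only [sub_zero, max_eq_left (hp.nonneg _)] using this

/-- A part `Z` of `R` cut out by a convex set `C` is contractible and geodesic. -/
theorem contractible_and_geodesic {R R' Z : Set (Pt S)} (hR : IsBalanced R) (hR' : IsBalanced R')
    (hcore : IsCore μ R') (himg : (diagLine S).mkQ '' R = (diagLine S).mkQ '' R')
    {ψ : Pt S → Pt S} (hψ : ∀ p, IsTight μ p → ψ p ∈ R') (hψR : ∀ p ∈ R', ψ p = p)
    (hne : ∀ p q, IsTight μ p → IsTight μ q → dSym (ψ p) (ψ q) ≤ dSym p q)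
    (hZ : Z ⊆ R) {C : Set (S → ℝ)} (hC : Convex ℝ C) (hC0 : C.Nonempty)
    (hpos : ∀ x ∈ C, ∀ s, 0 ≤ x s)
    (hZC : ∀ p ∈ Z, ∀ p' ∈ R', p - p' ∈ diagLine S → (fun s => p' (inl s)) ∈ C)
    (hCZ : ∀ x ∈ C, ∀ p ∈ R, p - ψ (hull μ x) ∈ diagLine S → p ∈ Z) :
    ContractibleSpace Z ∧ IsGeodesic Z := by
  classical
  have hα : ∀ p, ∃ p', p ∈ R → p' ∈ R' ∧ p - p' ∈ diagLine S := fun p => by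
    by_cases hp : p ∈ R
    · obtain ⟨p', h1, h2⟩ := exists_sub_mem_of_mkQ_image_eq himg hp
      exact ⟨p', fun _ => ⟨h1, h2⟩⟩
    · exact ⟨p, fun h => absurd h hp⟩
  have hβ : ∀ p, ∃ p', p ∈ R' → p' ∈ R ∧ p' - p ∈ diagLine S := fun p => by
    by_cases hp : p ∈ R'
    · obtain ⟨p', h1, h2⟩ := exists_sub_mem_of_mkQ_image_eq himg.symm hp
      exact ⟨p', fun _ => ⟨h1, by rw [← neg_sub]; exact neg_mem h2⟩⟩
    · exact ⟨p, fun h => absurd h hp⟩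
  choose α hα using hα
  choose β hβ using hβ
  let ι : Pt S → S → ℝ := fun p s => α p (inl s)
  let f : (S → ℝ) → Pt S := fun x => β (ψ (hull μ x))
  have hι : ∀ p ∈ Z, ι p ∈ C := fun p hp => hZC p hp _ (hα p (hZ hp)).1 (hα p (hZ hp)).2
  have hT : ∀ x ∈ C, IsTight μ (hull μ x) := fun x hx => isTight_hull μ (hpos x hx)
  have hf : ∀ x ∈ C, f x ∈ Z := fun x hx => by
    have := hβ _ (hψ _ (hT x hx))
    exact hCZ x hx _ this.1 this.2
  have hfι : ∀ p ∈ Z, f (ι p) = p := fun p hp => by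
    obtain ⟨h1, h2⟩ := hα p (hZ hp)
    have he : f (ι p) = β (α p) := by
      simp only [f, ι, (hcore.tight _ h1).hull_eq, hψR _ h1]
    rw [he]
    refine eq_of_dSym_le_zero ((hR.dSym_le (hβ _ h1).1 (hZ hp) (hβ _ h1).2 h2).trans ?_)
    simp [dSym, dInf_self]
  have hd : ∀ p ∈ Z, ∀ q ∈ Z, vSym (ι p) (ι q) = dSym p q := fun p hp q hq => by
    obtain ⟨p1, p2⟩ := hα p (hZ hp)
    obtain ⟨q1, q2⟩ := hα q (hZ hq)
    have : vSym (ι p) (ι q) = dSym (α p) (α q) := by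
      unfold vSym dSym
      rw [(hcore.tight _ p1).dInf_eq (hcore.tight _ q1),
        (hcore.tight _ q1).dInf_eq (hcore.tight _ p1)]
    rw [this]
    refine le_antisymm (hR'.dSym_le p1 q1 ?_ ?_) (hR.dSym_le (hZ hp) (hZ hq) p2 q2)
    · rw [← neg_sub]
      exact neg_mem p2
    · rw [← neg_sub]
      exact neg_mem q2
  have hle : ∀ x ∈ C, ∀ y ∈ C, dSym (f x) (f y) ≤ vSym x y := fun x hx y hy => by
    have h1 := hβ _ (hψ _ (hT x hx))
    have h2 := hβ _ (hψ _ (hT y hy))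
    exact ((hR.dSym_le h1.1 h2.1 h1.2 h2.2).trans (hne _ _ (hT x hx) (hT y hy))).trans
      (dSym_hull_le μ x y)
  exact ⟨contractibleSpace_of_retract hC hC0 ι f hι hf hfι hd hle,
    isGeodesic_of_retract hC ι f hι hf hfι hd hle⟩

theorem IsCore.exists_dInf_le (hμ : IsDirectedDistance μ) {R : Set (Pt S)} (hR : IsCore μ R)
    (s t : S) : ∃ p ∈ R, ZeroAt p s ∧ ∃ q ∈ R, ZeroAt q t ∧ dInf p q ≤ μ s t := by
  obtain ⟨ψ, hψ, -, -, hz, hr, hc⟩ := hR.exists_retraction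
  -- The first term makes the hull vanish at s; the second keeps its t^r-coordinate at most μ(s,t).
  set x : S → ℝ := fun u => max (μ u s) (μ u t - μ s t) with hx
  have hx0 : ∀ u, 0 ≤ x u := fun u => (hμ.nonneg u s).trans (le_max_left _ _)
  have hpT := isTight_hull μ hx0
  have hps : ZeroAt (hull μ x) s :=
    zeroAt_hull hx0 (by simp [hx, hμ.diag]) fun u => le_max_left _ _
  have hpt : hull μ x (inr t) ≤ μ s t :=
    dual_le_iff.2 ⟨hμ.nonneg _ _, fun u => by linarith [le_max_right (μ u s) (μ u t - μ s t)]⟩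
  by_cases hpz : ZeroAt (hull μ x) t
  · refine ⟨_, hψ _ hpT, hz _ hpT s hps, _, hψ _ hpT, hz _ hpT t hpz, ?_⟩
    rw [dInf_self]
    exact hμ.nonneg _ _
  -- `DownFat` would need the t^c-coordinate to exceed μ(t,s). Thus ψ does not raise S^r.
  have hnd : ¬IsDown μ R (hull μ x) := fun h => by
    have h1 := (h.fat t hpz).2 s hps
    have h2 : hull μ x (inl t) ≤ μ t s := (hull_inl_le hx0 t).trans
      (max_le le_rfl (by linarith [hμ.nonneg s t, hμ.nonneg t s, hμ.diag t]))
    linarith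
  set p := ψ (hull μ x) with hp
  have hpR := hψ _ hpT
  have hpt' : p (inr t) ≤ μ s t := (hr _ hpT hnd t).trans hpt
  have hps' : ZeroAt p s := hz _ hpT s hps
  have hpT' := hR.tight p hpR
  -- Dual construction: the second term gives a zero at t, the first keeps D_∞(p, q) at most p(t^r).
  set y : S → ℝ := fun v => max (p (inr v) - p (inr t)) (μ t v) with hy
  have hy0 : ∀ v, 0 ≤ y v := fun v => (hμ.nonneg t v).trans (le_max_right _ _)
  set q := swapPt (hull (tr μ) y) with hq
  have hqT : IsTight μ q := (isTight_hull (tr μ) hy0).swap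
  have hqt : ZeroAt q t :=
    zeroAt_swapPt.2 (zeroAt_hull hy0 (by simp [hy, hμ.diag]) fun u => le_max_right _ _)
  have hqc : ∀ u, q (inl u) ≤ p (inl u) + p (inr t) := fun u => by
    refine dual_le_iff.2 ⟨add_nonneg (hpT'.nonneg _) (hpT'.nonneg _), fun v => ?_⟩
    linarith [hpT'.le u v, le_max_left (p (inr v) - p (inr t)) (μ t v)]
  have hqs : q (inr s) ≤ μ t s := by
    refine (hull_inl_le hy0 s).trans (max_le ?_ le_rfl)
    rw [hps'.2]
    linarith [hpT'.nonneg (inr t), hμ.nonneg t s]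
  have fin : (∀ u, ψ q (inl u) ≤ p (inl u) + p (inr t)) → dInf p (ψ q) ≤ μ s t := fun h =>
    (hpT'.dInf_le (hR.tight _ (hψ q hqT)) (hpT'.nonneg _) h).trans hpt'
  refine ⟨p, hpR, hps', ψ q, hψ q hqT, hz q hqT t hqt, fin fun u => ?_⟩
  -- Zeros of q at both s and t would give μ(s,t) = μ(t,s) = 0, and then the first hull would vanish
  -- at t.
  have hqz : ¬ZeroAt q s := fun hqz => by
    have h1 := hqT.le s t
    have h2 := hqT.le t s
    rw [hqz.1, hqt.2] at h1
    rw [hqt.1, hqz.2] at h2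
    refine hpz (zeroAt_hull hx0 (max_le ?_ ?_) fun u => ?_)
    · linarith
    · linarith [hμ.nonneg s t, hμ.diag t]
    · linarith [le_max_right (μ u s) (μ u t - μ s t)]
  have hnu : ¬IsUp μ R q := fun h => by
    have := (h.fat s hqz).2 t hqt
    linarith
  exact (hc q hqT hnu u).trans (hqc u)

end Main

end SlimTropical

theorem mainTheorem11 {S : Type*} [Fintype S] [Nonempty S] (μ : S → S → ℝ)
    (hμ : SlimTropical.IsDirectedDistance μ) (R : Set (SlimTropical.Pt S))
    (hR : SlimTropical.IsSlimmedSection μ R) :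
    (ContractibleSpace R ∧ SlimTropical.IsGeodesic R ∧
      ∀ s : S, ContractibleSpace (SlimTropical.region R s) ∧
        SlimTropical.IsGeodesic (SlimTropical.region R s)) ∧
    (R ⊆ SlimTropical.nonnegPart (SlimTropical.Q μ) →
      ∀ s t : S, IsGLB {x : ℝ | ∃ p ∈ SlimTropical.region R s, ∃ q ∈ SlimTropical.region R t,
        x = SlimTropical.dInf p q} (μ s t)) := by
  open SlimTropical in
  obtain ⟨R', hR', himg⟩ := hR.exists_pos
  have hcore := hR'.isCore hμ
  obtain ⟨ψ, hψ, hψR, hne, hz, -, -⟩ := hcore.exists_retraction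
  refine ⟨?_, fun hpos s t => ?_⟩
  · rw [← and_assoc]
    refine ⟨contractible_and_geodesic hR.balanced hR'.balanced hcore himg hψ hψR hne subset_rfl
      (C := {x | ∀ s, 0 ≤ x s}) ?_ ⟨0, fun _ => le_rfl⟩ (fun x hx => hx) ?_ ?_, fun s =>
      contractible_and_geodesic hR.balanced hR'.balanced hcore himg hψ hψR hne (fun p hp => hp.1)
      -- These conditions hold for the S^c-part of any tight point vanishing at s, and conversely
      -- make the hull vanish at s.
      (C := {x | (∀ u, 0 ≤ x u) ∧ x s ≤ 0 ∧ ∀ u, μ u s ≤ x u}) ?_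
      ⟨fun u => μ u s, fun u => hμ.nonneg u s, (hμ.diag s).le, fun _ => le_rfl⟩
      (fun x hx => hx.1) ?_ ?_⟩
    · exact convex_Ici (0 : S → ℝ)
    · exact fun p _ p' hp' _ s => (hcore.tight p' hp').nonneg _
    · exact fun x _ p hp _ => hp
    · have h1 : Convex ℝ {x : S → ℝ | x s ≤ 0} :=
        (convex_Iic (0 : ℝ)).is_linear_preimage ⟨fun _ _ => rfl, fun _ _ => rfl⟩
      exact (convex_Ici (0 : S → ℝ)).inter (h1.inter (convex_Ici fun u => μ u s))
    · intro p hp p' hp' hpp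
      have hT := hcore.tight p' hp'
      have hz' : ZeroAt p' s := by
        rw [zeroAt_iff_add_eq_zero hT.nonneg, ← sum_eq_of_sub_mem hpp]
        exact hp.2
      refine ⟨fun u => hT.nonneg _, hz'.1.le, fun u => ?_⟩
      have := hT.le u s
      rwa [hz'.2, add_zero] at this
    · intro x hx p hp hpp
      have hzx := hz _ (isTight_hull μ hx.1) s (zeroAt_hull hx.1 hx.2.1 hx.2.2)
      refine ⟨hp, ?_⟩
      rw [sum_eq_of_sub_mem hpp, hzx.1, hzx.2, add_zero]
  · have hmem : ∀ p' ∈ R', ∀ u, ZeroAt p' u → p' ∈ region R u := fun p' hp' u hu => by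
      obtain ⟨p, hp, hpp⟩ := exists_sub_mem_of_mkQ_image_eq himg.symm hp'
      obtain ⟨a, a1, a2⟩ := mem_diagLine.1 hpp
      have e1 := a1 u
      have e2 := a2 u
      simp only [Pi.sub_apply, hu.1, hu.2] at e1 e2
      have n1 := (hpos hp).2 (Sum.inl u)
      have n2 := (hpos hp).2 (Sum.inr u)
      -- As p' vanishes at u, both a and -a are negatives of nonnegative coordinates of p.
      have ha : a = 0 := by linarith
      have : p' = p := by
        ext w
        rcases w with v | v
        · linarith [a1 v, Pi.sub_apply p' p (Sum.inl v)]
        · linarith [a2 v, Pi.sub_apply p' p (Sum.inr v)]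
      exact ⟨this ▸ hp, by rw [hu.1, hu.2, add_zero]⟩
    have hlow : ∀ p ∈ region R s, ∀ q ∈ region R t, μ s t ≤ dInf p q := fun p hp q hq => by
      have hp0 := (zeroAt_iff_add_eq_zero (hpos hp.1).2).2 hp.2
      have hq0 := (zeroAt_iff_add_eq_zero (hpos hq.1).2).2 hq.2
      have h1 := (hpos hq.1).1.1 s t
      have h2 := inl_le_add_dInf p q s
      rw [hq0.2] at h1
      rw [hp0.1] at h2
      linarith
    obtain ⟨p, hp, hps, q, hq, hqt, hle⟩ := hcore.exists_dInf_le hμ s t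
    have h1 := hmem p hp s hps
    have h2 := hmem q hq t hqt
    refine IsLeast.isGLB ⟨⟨p, h1, q, h2, (hlow p h1 q h2).antisymm hle⟩, ?_⟩
    rintro _ ⟨p, hp, q, hq, rfl⟩
    exact hlow p hp q hq
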